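/- Let $G$ be a simply connected nilpotent (real, finite-dimensional) Lie group with Lie algebra $\mathfrak g$, with exponential map $\exp:\mathfrak g\to G$ (a bijection) and inverse $\log:G\to\mathfrak g$. The step of $G$ is the length $s$ of the lower central series of $\mathfrak g$, i.e. the least $s$ such that all $(s+1)$-fold iterated brackets in $\mathfrak g$ vanish. A set $A\subseteq\mathfrak g$ is bracket-closed if $[X,Y]\in A$ for all $X,Y\in A$; $\mathscr B(A)$ denotes the smallest bracket-closed set containing $A$; $\operatorname{span}_{\mathbb Z}(A)$ is the additive subgroup generated by $A$; and $\lambda\cdot A=\{\lambda a:a\in A\}$ for $\lambda\in\mathbb R$. A subgroup $H$ of $G$ is harmonious if $\log H$ is a bracket-closed additive subgroup of $\mathfrak g$. **Theorem.** For every $s$ there exist positive integers $C_1$ and $C_2$, depending only on $s$, such that if $G$ is a simply connected nilpotent Lie group of step $s$ and $\Gamma$ is any (not necessarily discrete) subgroup of $G$, then the sets $$\mathscr H_-(\Gamma)=\exp\bigl(C_1\cdot\operatorname{span}_{\mathbb Z}(\log\Gamma)\bigr)\quad\text{and}\quad \mathscr H_+(\Gamma)=\exp\Bigl(C_1\cdot\operatorname{span}_{\mathbb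 Z}\mathscr B\bigl(\tfrac1{C_1}\cdot\operatorname{span}_{\mathbb Z}(\log\Gamma)\bigr)\Bigr)$$ are harmonious subgroups of $G$ such that $$C_1\cdot\log\Gamma\subseteq\log\mathscr H_-(\Gamma)\subseteq\log\Gamma\subseteq\log\mathscr H_+(\Gamma)\subseteq\tfrac1{C_2}\cdot\log\Gamma .$$ -/

import Mathlib

open scoped Manifold ContDiff Pointwise

universe u

namespace NilLie

/-- Over `ℝ`, Mathlib's Lie bracket on the tangent space at the identity needs a group of class
`C^3`; with this instance it is available for every smooth Lie group. -/
instance instLEInftyMinSmoothness : ENat.LEInfty (minSmoothness ℝ 3) :=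
  ⟨by simpa using (ENat.LEInfty.out : (3 : WithTop ℕ∞) ≤ ∞)⟩

/-- The Lie algebra of a `d`-dimensional Lie group `G`: the tangent space at the identity, with the
bracket coming from left-invariant vector fields. -/
abbrev LieAlg (d : ℕ) (G : Type u) [TopologicalSpace G]
    [ChartedSpace (EuclideanSpace ℝ (Fin d)) G] [Group G] : Type :=
  GroupLieAlgebra (𝓡 d) G

variable {d : ℕ} {G : Type u} [TopologicalSpace G] [ChartedSpace (EuclideanSpace ℝ (Fin d)) G]
  [Group G] [LieGroup (𝓡 d) ∞ G]

/-! ### The exponential map -/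

/-- A Lie group is Hausdorff. -/
theorem t2Space_of_lieGroup (d : ℕ) (G : Type u) [TopologicalSpace G]
    [ChartedSpace (EuclideanSpace ℝ (Fin d)) G] [Group G] [LieGroup (𝓡 d) ∞ G] : T2Space G := by
  have := topologicalGroup_of_lieGroup (𝓡 d) ∞ (G := G)
  have := ChartedSpace.t1Space (EuclideanSpace ℝ (Fin d)) G
  infer_instance

theorem contMDiff_leftInvariant (X : LieAlg d G) :
    ContMDiff (𝓡 d) (𝓡 d).tangent 1
      (fun g : G ↦ (⟨g, mulInvariantVectorField X g⟩ : TangentBundle (𝓡 d) G)) :=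
  (contMDiff_mulInvariantVectorField X).of_le (by simp)

/-- Left translates of integral curves of a left-invariant field are again integral curves. -/
theorem leftTranslate_isMIntegralCurveOn (X : LieAlg d G) (g : G) {γ : ℝ → G} {s : Set ℝ}
    (h : IsMIntegralCurveOn γ (mulInvariantVectorField (I := 𝓡 d) X) s) :
    IsMIntegralCurveOn (fun t ↦ g * γ t) (mulInvariantVectorField (I := 𝓡 d) X) s := by
  intro t ht
  have hd : ∀ a b : G, MDifferentiableAt (𝓡 d) (𝓡 d) (fun x : G ↦ a * x) b := fun a b ↦
    (contMDiff_mul_left (I := 𝓡 d) (n := ∞)).contMDiffAt.mdifferentiableAt (by simp)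
  have h1 := (hd g (γ t)).hasMFDerivAt.comp_hasMFDerivWithinAt t (h t ht)
  have h2 : mulInvariantVectorField (I := 𝓡 d) X (g * γ t)
      = mfderiv (𝓡 d) (𝓡 d) (fun x : G ↦ g * x) (γ t)
        (mulInvariantVectorField (I := 𝓡 d) X (γ t)) := by
    have hc : (fun x : G ↦ g * γ t * x) = (fun x ↦ g * x) ∘ (fun x ↦ γ t * x) := by
      ext x; simp [mul_assoc]
    have h3 := mfderiv_comp_apply_of_eq (I := 𝓡 d) (I' := 𝓡 d) (I'' := 𝓡 d) (x := (1 : G))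
      (y := γ t) (f := fun x : G ↦ γ t * x) (g := fun x : G ↦ g * x)
      (hd _ _) (hd _ _) (by simp) X
    rw [← hc] at h3
    exact h3
  rw [h2]
  refine HasMFDerivWithinAt.congr_mfderiv h1 ?_
  exact ContinuousLinearMap.ext fun r : ℝ ↦ map_smul
    (mfderiv (𝓡 d) (𝓡 d) (fun x : G ↦ g * x) (γ t)) r (mulInvariantVectorField (I := 𝓡 d) X (γ t))

/-- For every `X` in the Lie algebra there is a unique one-parameter curve through the identity
that is tangent everywhere to the left-invariant vector field of `X`. -/
theorem existsUnique_integralCurve (X : LieAlg d G) :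
    ∃! γ : ℝ → G, γ 0 = 1 ∧ IsMIntegralCurve γ (mulInvariantVectorField (I := 𝓡 d) X) := by
  have := t2Space_of_lieGroup d G
  have : IsManifold (𝓡 d) 1 G := IsManifold.of_le (n := ∞) (by simp)
  obtain ⟨γ, h0, h⟩ := exists_isMIntegralCurveAt_of_contMDiffAt_boundaryless 0
    (contMDiff_leftInvariant X (1 : G))
  obtain ⟨ε, hε, h⟩ := isMIntegralCurveAt_iff'.1 h
  obtain ⟨δ, hδ0, hδ⟩ := exists_isMIntegralCurve_of_isMIntegralCurveOn
    (contMDiff_leftInvariant X) hε (fun g ↦ ⟨fun t ↦ g * γ t, by simp [h0], by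
      have := leftTranslate_isMIntegralCurveOn X g h
      rwa [Real.ball_eq_Ioo, zero_sub, zero_add] at this⟩) (1 : G)
  refine ⟨δ, ⟨hδ0, hδ⟩, fun η hη ↦ ?_⟩
  exact isMIntegralCurve_Ioo_eq_of_contMDiff_boundaryless (t₀ := 0)
    (contMDiff_leftInvariant X) hη.2 hδ (by rw [hη.1, hδ0])

/-- The exponential map of a Lie group: `lieExp X = γ 1`, where `γ` is the integral curve with
`γ 0 = 1` of the left-invariant vector field of `X`. -/
noncomputable def lieExp (X : LieAlg d G) : G :=
  (existsUnique_integralCurve X).choose 1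

theorem lieExp_eq {X : LieAlg d G} {γ : ℝ → G} (h0 : γ 0 = 1)
    (h : IsMIntegralCurve γ (mulInvariantVectorField (I := 𝓡 d) X)) : lieExp X = γ 1 := by
  have h1 := (existsUnique_integralCurve X).unique
    (existsUnique_integralCurve X).choose_spec.1 ⟨h0, h⟩
  exact congrFun h1 1

/-- The logarithm of a Lie group, the inverse of the exponential map. (The exponential map of a
simply connected nilpotent Lie group is a bijection.) -/
noncomputable def lieLog : G → LieAlg d G :=
  Function.invFun lieExp

/-- `log S = {log x : x ∈ S}` for a subset `S` of `G`. -/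
noncomputable def logSet (S : Set G) : Set (LieAlg d G) :=
  lieLog '' S

/-- `exp A = {exp X : X ∈ A}` for a subset `A` of the Lie algebra. -/
noncomputable def expSet (A : Set (LieAlg d G)) : Set G :=
  lieExp '' A

/-! ### Nilpotency step, bracket closure, harmonious subgroups -/

/-- The Lie algebra of `G` is nilpotent of step (exactly) `s`: in the lower central series
`𝔤₀ = 𝔤`, `𝔤ₖ₊₁ = [𝔤, 𝔤ₖ]`, the term `𝔤ₛ` vanishes and `s` is the least index with this
property. -/
def HasStep (d : ℕ) (G : Type u) [TopologicalSpace G] [ChartedSpace (EuclideanSpace ℝ (Fin d)) G]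
    [Group G] [LieGroup (𝓡 d) ∞ G] (s : ℕ) : Prop :=
  IsLeast {k : ℕ | LieModule.lowerCentralSeries ℝ (LieAlg d G) (LieAlg d G) k = ⊥} s

/-- A subset `A` of a Lie algebra is bracket-closed if `[X, Y] ∈ A` for all `X, Y ∈ A`. -/
def BracketClosed {L : Type*} [LieRing L] (A : Set L) : Prop :=
  ∀ X ∈ A, ∀ Y ∈ A, ⁅X, Y⁆ ∈ A

/-- The smallest bracket-closed set containing `A`. -/
def bracketClosure {L : Type*} [LieRing L] (A : Set L) : Set L :=
  ⋂₀ {B : Set L | A ⊆ B ∧ BracketClosed B}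

/-- The set of integer linear combinations of elements of `A`. -/
def spanZ {L : Type*} [LieRing L] (A : Set L) : Set L :=
  (Submodule.span ℤ A : Set L)

/-- A subgroup `H` of `G` is harmonious if `log H` is a bracket-closed additive subgroup of the
Lie algebra. -/
def IsHarmonious (d : ℕ) {G : Type u} [TopologicalSpace G]
    [ChartedSpace (EuclideanSpace ℝ (Fin d)) G] [Group G] [LieGroup (𝓡 d) ∞ G]
    (H : Subgroup G) : Prop :=
  (∃ Λ : AddSubgroup (LieAlg d G), (Λ : Set (LieAlg d G)) = logSet (H : Set G)) ∧
    BracketClosed (logSet (d := d) (H : Set G))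

/-- `H₋(Γ) = exp (C · span_ℤ (log Γ))`. -/
noncomputable def hMinus (d : ℕ) {G : Type u} [TopologicalSpace G]
    [ChartedSpace (EuclideanSpace ℝ (Fin d)) G] [Group G] [LieGroup (𝓡 d) ∞ G]
    (C : ℕ) (Γ : Subgroup G) : Set G :=
  expSet ((C : ℝ) • spanZ (logSet (d := d) (Γ : Set G)))

/-- `H₊(Γ) = exp (C · span_ℤ (B ((1 / C) · span_ℤ (log Γ))))`, where `B` is the bracket closure.
A bracket closure of sets need not be closed under addition, so the outer integer span is
needed. -/
noncomputable def hPlus (d : ℕ) {G : Type u} [TopologicalSpace G]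
    [ChartedSpace (EuclideanSpace ℝ (Fin d)) G] [Group G] [LieGroup (𝓡 d) ∞ G]
    (C : ℕ) (Γ : Subgroup G) : Set G :=
  expSet ((C : ℝ) • spanZ (bracketClosure
    ((1 / (C : ℝ)) • spanZ (logSet (d := d) (Γ : Set G)))))

end NilLie

/-! Write `A = log Γ`. The Baker–Campbell–Hausdorff (BCH) product in step `s` is a finite sum of
iterated brackets with rational coefficients, so some integer `D` depending only on `s` clears all
denominators: if `B` is a Lie ring, then `log (exp x * exp y)` for `x, y ∈ D • B` lies in `x + y + D
• [B, B]`. Hence `exp (D • B)` is a subgroup (`IsNilpotentExp.exists_subgroup`), and every multiple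
of `D` serves as well.

The main point is that a bounded multiple of the Lie ring generated by `D⁻¹ • A`, scaled back by
`D`, falls inside `A` (`exists_smul_mem_of_mem_bracketFiltration`). Let `F k` be the lower central
filtration of that Lie ring. Modulo deeper terms, products in `Γ` are sums and group commutators are
brackets, so a suitable `D`-power multiple of any element of `D • F (n + 1)` agrees with an element
of `A` modulo `D • F (n + 2)`. The error is absorbed by descending induction on the depth, which
ends because `F k = 0` for `k > s`.

This yields `C` with `C • D • F 1 ⊆ A`, and `C₁ = D * C`. Brackets of elements of `A` lie in `D • F
1`, so `C • span A` is a Lie ring, and its `D`-multiple is `log H₋`. The set `log H₊` is `C₁` times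
the Lie ring generated by `C₁⁻¹ • A`, so it is a group for the same reason, and the main point
applied with `C₁` in place of `D` supplies `C₂`.

It remains to show that `lieExp` is a bijection obeying the BCH formula (`isNilpotentExp_lieExp`).
In the chart at the identity, `Ad (exp X) = exp (ad X)` is found from a linear differential
equation, and the derivative of `exp` from the curve `t ↦ exp (-t z) * exp (t y)`. The BCH formula
follows from uniqueness of curves with a given constant left logarithmic derivative. The derivative
is onto, so `exp` is open, and connectedness gives surjectivity. Finally `exp` is a covering whose
fibres are cosets of a discrete subgroup, trivial because `G` is simply connected. -/

namespace NilLie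

open Finset

/-! ### The coefficients of the Baker–Campbell–Hausdorff series -/

section BCH

/-- The power series of `(1 - exp (-z)) / z`. -/
noncomputable def dexpSeries : PowerSeries ℚ :=
  PowerSeries.mk fun n ↦ (-1) ^ n / (n + 1).factorial

/-- The coefficients of the power series of `z / (1 - exp (-z))`. -/
noncomputable def dexpInvCoeff (k : ℕ) : ℚ :=
  PowerSeries.coeff k dexpSeries⁻¹

theorem dexpInvCoeff_zero : dexpInvCoeff 0 = 1 := by
  simp [dexpInvCoeff, dexpSeries]

theorem sum_dexpInvCoeff (n : ℕ) :
    ∑ p ∈ antidiagonal n, ((-1) ^ p.1 / (p.1 + 1).factorial : ℚ) * dexpInvCoeff p.2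
      = if n = 0 then 1 else 0 := by
  have h : dexpSeries * dexpSeries⁻¹ = 1 := PowerSeries.mul_inv_cancel _ (by simp [dexpSeries])
  have := congrArg (PowerSeries.coeff n) h
  rw [PowerSeries.coeff_mul, PowerSeries.coeff_one] at this
  simpa [dexpSeries, dexpInvCoeff] using this

variable {L : Type*} [LieRing L]

/-- The coefficients of `(ad c) ^ k y` for a formal curve `c`. -/
def adPowCoeff (c : ℕ → L) (y : L) : ℕ → ℕ → L
  | 0, n => if n = 0 then y else 0
  | k + 1, n => ∑ p ∈ antidiagonal n, ⁅c p.1, adPowCoeff c y k p.2⁆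

theorem adPowCoeff_congr {c c' : ℕ → L} (y : L) {n : ℕ} (h : ∀ i ≤ n, c i = c' i) (k : ℕ) :
    ∀ m ≤ n, adPowCoeff c y k m = adPowCoeff c' y k m := by
  induction k with
  | zero => intro m _; rfl
  | succ k ih =>
    intro m hm
    refine sum_congr rfl fun p hp ↦ ?_
    have := mem_antidiagonal.1 hp
    rw [h p.1 (by lia), ih p.2 (by lia)]

/-- A decreasing filtration by additive subgroups compatible with the bracket. -/
structure IsLieFiltration (T : ℕ → AddSubgroup L) : Prop where
  antitone : Antitone T
  lie_mem : ∀ {i j : ℕ} {x y : L}, x ∈ T i → y ∈ T j → ⁅x, y⁆ ∈ T (i + j)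

variable [LieAlgebra ℝ L]

/-- One step of the Picard iteration for `c' = ∑ k ≤ s, dexpInvCoeff k • (ad c) ^ k y`, `c 0 = x`,
on coefficient sequences. -/
noncomputable def bchStep (s : ℕ) (x y : L) (c : ℕ → L) : ℕ → L
  | 0 => x
  | n + 1 => ((n : ℝ) + 1)⁻¹ • ∑ k ∈ range (s + 1), (dexpInvCoeff k : ℝ) • adPowCoeff c y k n

/-- The coefficient of `t ^ n` in `log (exp x * exp (t y))`. -/
noncomputable def bchCoeff (s : ℕ) (x y : L) (n : ℕ) : L :=
  (bchStep s x y)^[n] (fun _ ↦ x) n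

/-- Each Picard step computes coefficient `n + 1` from those of index at most `n`, so coefficient
`i` is final after `i` steps. -/
theorem bchStep_iterate_congr (s : ℕ) (x y : L) (n k : ℕ) :
    ∀ i ≤ n, (bchStep s x y)^[n] (fun _ ↦ x) i = (bchStep s x y)^[n + k] (fun _ ↦ x) i := by
  induction n with
  | zero =>
    intro i hi
    obtain rfl : i = 0 := by lia
    rcases k with _ | k
    · rfl
    · rw [zero_add, Function.iterate_succ_apply']; rfl
  | succ n ih =>
    intro i hi
    rw [Nat.succ_add, Function.iterate_succ_apply', Function.iterate_succ_apply']
    rcases i with _ | i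
    · rfl
    · simp only [bchStep]
      congr 1
      refine sum_congr rfl fun j _ ↦ ?_
      rw [adPowCoeff_congr y ih j i (by lia)]

theorem bchCoeff_zero (s : ℕ) (x y : L) : bchCoeff s x y 0 = x := rfl

theorem bchCoeff_succ (s : ℕ) (x y : L) (n : ℕ) :
    bchCoeff s x y (n + 1) = ((n : ℝ) + 1)⁻¹ •
      ∑ k ∈ range (s + 1), (dexpInvCoeff k : ℝ) • adPowCoeff (bchCoeff s x y) y k n := by
  rw [bchCoeff, Function.iterate_succ_apply', bchStep]
  congr 1
  refine sum_congr rfl fun k _ ↦ ?_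
  rw [adPowCoeff_congr y (c' := bchCoeff s x y) (fun i hi ↦ ?_) k n le_rfl]
  obtain ⟨j, rfl⟩ := Nat.exists_eq_add_of_le hi
  exact (bchStep_iterate_congr s x y i j i le_rfl).symm

/-- The curve `t ↦ log (exp x * exp (t y))` in a nilpotent Lie algebra of step `s`. -/
noncomputable def bchCurve (s : ℕ) (x y : L) (t : ℝ) : L :=
  ∑ n ∈ range (s + 1), t ^ n • bchCoeff s x y n

/-- The Baker–Campbell–Hausdorff product in a nilpotent Lie algebra of step `s`. -/
noncomputable def bch (s : ℕ) (x y : L) : L :=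
  ∑ n ∈ range (s + 1), bchCoeff s x y n

theorem bchCurve_one (s : ℕ) (x y : L) : bchCurve s x y 1 = bch s x y := by
  simp [bchCurve, bch]

theorem bchCurve_zero (s : ℕ) (x y : L) : bchCurve s x y 0 = x := by
  rw [bchCurve, sum_range_succ', sum_eq_zero (fun n _ ↦ by simp)]
  simp [bchCoeff_zero]

/-- The derivative of `bchCurve`. -/
noncomputable def bchCurveDeriv (s : ℕ) (x y : L) (t : ℝ) : L :=
  ∑ n ∈ range s, t ^ n • ((n : ℝ) + 1) • bchCoeff s x y (n + 1)

/-- The truncated series of `exp (ad x) y`. -/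
noncomputable def expAd (s : ℕ) (x y : L) : L :=
  ∑ k ∈ range (s + 1), ((k.factorial : ℝ)⁻¹) • ((LieAlgebra.ad ℝ L x) ^ k) y

/-! ### Filtrations -/

/-- Induction on `i`, moving a bracket out of the left entry with the Jacobi identity. The extra `1`
comes from indexing the series from `0`. -/
theorem lie_mem_lowerCentralSeries {i j : ℕ} {x y : L}
    (hx : x ∈ LieModule.lowerCentralSeries ℝ L L i)
    (hy : y ∈ LieModule.lowerCentralSeries ℝ L L j) :
    ⁅x, y⁆ ∈ LieModule.lowerCentralSeries ℝ L L (i + j + 1) := by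
  induction i generalizing x y j with
  | zero =>
    rw [zero_add, LieModule.lowerCentralSeries_succ]
    exact LieSubmodule.lie_mem_lie (LieSubmodule.mem_top _) hy
  | succ i ih =>
    rw [LieModule.lowerCentralSeries_succ, ← LieSubmodule.mem_toSubmodule,
      LieSubmodule.lieIdeal_oper_eq_linear_span'] at hx
    induction hx using Submodule.span_induction with
    | mem x hx =>
      obtain ⟨u, -, v, hv, rfl⟩ := hx
      rw [lie_lie]
      have h1 : ⁅u, ⁅v, y⁆⁆ ∈ LieModule.lowerCentralSeries ℝ L L (i + j + 1 + 1) := by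
        rw [LieModule.lowerCentralSeries_succ]
        exact LieSubmodule.lie_mem_lie (LieSubmodule.mem_top _) (ih hv hy)
      have h2 : ⁅v, ⁅u, y⁆⁆ ∈ LieModule.lowerCentralSeries ℝ L L (i + (j + 1) + 1) := by
        refine ih hv ?_
        rw [LieModule.lowerCentralSeries_succ]
        exact LieSubmodule.lie_mem_lie (LieSubmodule.mem_top _) hy
      rw [show i + 1 + j + 1 = i + j + 1 + 1 by ring]
      rw [show i + (j + 1) + 1 = i + j + 1 + 1 by ring] at h2
      exact sub_mem h1 h2
    | zero => simp
    | add a b _ _ ha hb => rw [add_lie]; exact add_mem ha hb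
    | smul r a _ ha => rw [smul_lie]; exact SMulMemClass.smul_mem r ha

variable (L) in
/-- The lower central series, indexed so that the whole Lie algebra has weights `0` and `1`. -/
def lcsFiltration (i : ℕ) : Submodule ℝ L :=
  (LieModule.lowerCentralSeries ℝ L L (i - 1)).toSubmodule

theorem lie_mem_lcsFiltration {i j : ℕ} {x y : L} (hx : x ∈ lcsFiltration L i)
    (hy : y ∈ lcsFiltration L j) : ⁅x, y⁆ ∈ lcsFiltration L (i + j) :=
  LieModule.antitone_lowerCentralSeries ℝ L L (show i + j - 1 ≤ i - 1 + (j - 1) + 1 by lia)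
    (lie_mem_lowerCentralSeries hx hy)

theorem mem_lcsFiltration_of_le_one {i : ℕ} (hi : i ≤ 1) (x : L) : x ∈ lcsFiltration L i := by
  simp [lcsFiltration, Nat.sub_eq_zero_of_le hi]

theorem eq_zero_of_mem_lcsFiltration {s : ℕ} (hs : LieModule.lowerCentralSeries ℝ L L s = ⊥)
    {i : ℕ} (hi : s < i) {x : L} (hx : x ∈ lcsFiltration L i) : x = 0 := by
  have h := LieModule.antitone_lowerCentralSeries ℝ L L (show s ≤ i - 1 by lia)
  rw [hs] at h
  exact (LieSubmodule.mem_bot _).1 (h hx)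

/-- Weights count occurrences of `y`: coefficient `i` of the curve has weight `i`, and the final `y`
adds one more. -/
theorem adPowCoeff_mem_lcs {c : ℕ → L} {y : L} {n : ℕ}
    (h : ∀ i ≤ n, c i ∈ lcsFiltration L i) (k : ℕ) :
    ∀ m ≤ n, adPowCoeff c y k m ∈ lcsFiltration L (m + 1) := by
  induction k with
  | zero =>
    intro m _
    rw [adPowCoeff]
    split_ifs with h0
    · exact mem_lcsFiltration_of_le_one (by lia) _
    · exact zero_mem _
  | succ k ih =>
    intro m hm
    refine Submodule.sum_mem _ fun p hp ↦ ?_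
    have hp := mem_antidiagonal.1 hp
    rw [show m + 1 = p.1 + (p.2 + 1) by lia]
    exact lie_mem_lcsFiltration (h p.1 (by lia)) (ih p.2 (by lia))

theorem bchCoeff_mem_lcs (s : ℕ) (x y : L) (n : ℕ) : bchCoeff s x y n ∈ lcsFiltration L n := by
  induction n using Nat.strong_induction_on with
  | _ n ih =>
    rcases n with _ | n
    · exact mem_lcsFiltration_of_le_one (by lia) _
    · rw [bchCoeff_succ]
      exact Submodule.smul_mem _ _ (Submodule.sum_mem _ fun k _ ↦ Submodule.smul_mem _ _
        (adPowCoeff_mem_lcs (fun i hi ↦ ih i (by lia)) k n le_rfl))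

theorem bchCoeff_eq_zero {s : ℕ} (hs : LieModule.lowerCentralSeries ℝ L L s = ⊥) (x y : L) {n : ℕ}
    (hn : s < n) : bchCoeff s x y n = 0 :=
  eq_zero_of_mem_lcsFiltration hs hn (bchCoeff_mem_lcs s x y n)

end BCH

/-! ### The BCH curve solves the inverse-dexp differential equation -/

section BCHCurve

/-- The Cauchy product of two truncated series; nilpotency will supply the vanishing beyond total
degree `s`. -/
theorem sum_range_antidiagonal {M : Type*} [AddCommMonoid M] (s : ℕ) (h : ℕ → ℕ → M)
    (hz : ∀ i j, s < i + j → h i j = 0) :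
    ∑ n ∈ range (s + 1), ∑ p ∈ antidiagonal n, h p.1 p.2
      = ∑ i ∈ range (s + 1), ∑ j ∈ range (s + 1), h i j := by
  rw [← sum_product', ← sum_filter_add_sum_filter_not (range (s + 1) ×ˢ range (s + 1))
    (fun p ↦ p.1 + p.2 ≤ s), sum_eq_zero (s := filter (fun p : ℕ × ℕ ↦ ¬ p.1 + p.2 ≤ s) _),
    add_zero]
  · rw [← sum_fiberwise_of_maps_to (t := range (s + 1)) (g := fun p : ℕ × ℕ ↦ p.1 + p.2)]
    · refine sum_congr rfl fun n hn ↦ sum_congr ?_ fun _ _ ↦ rfl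
      ext ⟨i, j⟩
      simp only [mem_range, HasAntidiagonal.mem_antidiagonal, mem_filter, mem_product] at hn ⊢
      lia
    · intro p hp
      simp only [mem_filter, mem_range] at hp ⊢
      lia
  · intro p hp
    simp only [mem_filter] at hp
    exact hz _ _ (by lia)

variable {L : Type*} [LieRing L] [LieAlgebra ℝ L]

theorem ad_pow_mem_lcs (x y : L) (k : ℕ) :
    ((LieAlgebra.ad ℝ L x) ^ k) y ∈ LieModule.lowerCentralSeries ℝ L L k := by
  rw [Module.End.pow_apply]
  exact LieModule.iterate_toEnd_mem_lowerCentralSeries ℝ L L x y k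

variable {s : ℕ}

theorem ad_pow_eq_zero (hs : LieModule.lowerCentralSeries ℝ L L s = ⊥) (x y : L) {k : ℕ}
    (hk : s ≤ k) : ((LieAlgebra.ad ℝ L x) ^ k) y = 0 := by
  have h := LieModule.antitone_lowerCentralSeries ℝ L L hk (ad_pow_mem_lcs x y k)
  rwa [hs, LieSubmodule.mem_bot] at h

theorem sum_adPowCoeff (hs : LieModule.lowerCentralSeries ℝ L L s = ⊥) {c : ℕ → L} (y : L)
    (hc : ∀ i, c i ∈ lcsFiltration L i) (t : ℝ) (k : ℕ) :
    ∑ n ∈ range (s + 1), t ^ n • adPowCoeff c y k n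
      = ((LieAlgebra.ad ℝ L (∑ n ∈ range (s + 1), t ^ n • c n)) ^ k) y := by
  induction k with
  | zero =>
    rw [sum_range_succ', sum_eq_zero (fun n _ ↦ by simp [adPowCoeff])]
    simp [adPowCoeff]
  | succ k ih =>
    rw [pow_succ', Module.End.mul_apply, ← ih, LieAlgebra.ad_apply, _root_.sum_lie_sum]
    rw [← sum_range_antidiagonal s
      (fun i j ↦ ⁅t ^ i • c i, t ^ j • adPowCoeff c y k j⁆)]
    · refine sum_congr rfl fun n _ ↦ ?_
      rw [adPowCoeff, smul_sum]
      refine sum_congr rfl fun p hp ↦ ?_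
      rw [smul_lie, lie_smul, smul_smul, ← pow_add, mem_antidiagonal.1 hp]
    · intro i j hij
      rw [smul_lie, lie_smul, eq_zero_of_mem_lcsFiltration hs (i := i + (j + 1)) (by lia)
        (lie_mem_lcsFiltration (hc i) (adPowCoeff_mem_lcs (fun i _ ↦ hc i) k j le_rfl))]
      simp

theorem bchCurveDeriv_eq (hs : LieModule.lowerCentralSeries ℝ L L s = ⊥) (x y : L) (t : ℝ) :
    bchCurveDeriv s x y t = ∑ k ∈ range (s + 1),
      (dexpInvCoeff k : ℝ) • ((LieAlgebra.ad ℝ L (bchCurve s x y t)) ^ k) y := by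
  have h1 : ∀ n : ℕ, ((n : ℝ) + 1) • bchCoeff s x y (n + 1) =
      ∑ k ∈ range (s + 1), (dexpInvCoeff k : ℝ) • adPowCoeff (bchCoeff s x y) y k n := by
    intro n
    rw [bchCoeff_succ, smul_smul, mul_inv_cancel₀ (by positivity), one_smul]
  have h2 : bchCurveDeriv s x y t
      = ∑ n ∈ range (s + 1), t ^ n • ((n : ℝ) + 1) • bchCoeff s x y (n + 1) := by
    rw [sum_range_succ, bchCoeff_eq_zero hs x y (Nat.lt_succ_self s)]
    simp [bchCurveDeriv]
  rw [h2]
  simp_rw [h1, smul_sum]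
  rw [sum_comm]
  refine sum_congr rfl fun k _ ↦ ?_
  rw [bchCurve, ← sum_adPowCoeff hs y (bchCoeff_mem_lcs s x y), smul_sum]
  exact sum_congr rfl fun n _ ↦ smul_comm _ _ _

/-- The left logarithmic derivative of the exponential map at `x`: the truncated series of
`(1 - exp (-ad x)) / ad x`. -/
noncomputable def dexp (s : ℕ) (x z : L) : L :=
  ∑ k ∈ range (s + 1), ((-1) ^ k / (k + 1).factorial : ℝ) • ((LieAlgebra.ad ℝ L x) ^ k) z

/-- The power series of `(1 - exp (-z)) / z` and `z / (1 - exp (-z))` are inverse to each other, and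
the truncation costs nothing since `ad x` is nilpotent. -/
theorem dexp_sum_dexpInvCoeff (hs : LieModule.lowerCentralSeries ℝ L L s = ⊥) (x y : L) :
    dexp s x (∑ k ∈ range (s + 1), (dexpInvCoeff k : ℝ) • ((LieAlgebra.ad ℝ L x) ^ k) y) = y := by
  rw [dexp]
  set A := LieAlgebra.ad ℝ L x
  have h1 : ∀ j ∈ range (s + 1), ((-1) ^ j / (j + 1).factorial : ℝ) •
      (A ^ j) (∑ k ∈ range (s + 1), (dexpInvCoeff k : ℝ) • (A ^ k) y)
      = ∑ k ∈ range (s + 1),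
        (((-1) ^ j / (j + 1).factorial : ℝ) * dexpInvCoeff k) • (A ^ (j + k)) y := by
    intro j _
    rw [map_sum, smul_sum]
    refine sum_congr rfl fun k _ ↦ ?_
    rw [map_smul, smul_smul, pow_add, Module.End.mul_apply]
  rw [sum_congr rfl h1, ← sum_range_antidiagonal s
    (fun j k ↦ (((-1) ^ j / (j + 1).factorial : ℝ) * dexpInvCoeff k) • (A ^ (j + k)) y)]
  · have h2 : ∀ n ∈ range (s + 1), ∑ p ∈ antidiagonal n,
        (((-1) ^ p.1 / (p.1 + 1).factorial : ℝ) * dexpInvCoeff p.2) • (A ^ (p.1 + p.2)) y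
        = if n = 0 then y else 0 := by
      intro n _
      have h3 := congrArg (Rat.cast : ℚ → ℝ) (sum_dexpInvCoeff n)
      push_cast at h3
      rw [sum_congr rfl (g := fun p ↦ (((-1) ^ p.1 / (p.1 + 1).factorial : ℝ) *
        dexpInvCoeff p.2) • (A ^ n) y) (fun p hp ↦ by rw [mem_antidiagonal.1 hp]),
        ← sum_smul, h3]
      split_ifs with h0 <;> simp [h0]
    rw [sum_congr rfl h2]
    simp
  · intro i j hij
    rw [ad_pow_eq_zero hs _ _ hij.le, smul_zero]

theorem dexp_bchCurveDeriv (hs : LieModule.lowerCentralSeries ℝ L L s = ⊥) (x y : L) (t : ℝ) :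
    dexp s (bchCurve s x y t) (bchCurveDeriv s x y t) = y := by
  rw [bchCurveDeriv_eq hs, dexp_sum_dexpInvCoeff hs]

end BCHCurve

/-! ### Clearing denominators -/

section Denominators

/-- `D` is divisible by the denominators occurring in the Baker–Campbell–Hausdorff series and in
the exponential series in step `s`. -/
def IsBCHDenominator (s D : ℕ) : Prop :=
  0 < D ∧ ∀ k ≤ s, (dexpInvCoeff k).den * s.factorial ∣ D

theorem exists_isBCHDenominator (s : ℕ) : ∃ D, IsBCHDenominator s D := by
  refine ⟨(∏ k ∈ range (s + 1), (dexpInvCoeff k).den) * s.factorial, ?_, fun k hk ↦ ?_⟩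
  · exact Nat.mul_pos (prod_pos fun k _ ↦ (dexpInvCoeff k).den_pos) s.factorial_pos
  · exact Nat.mul_dvd_mul_right (dvd_prod_of_mem _ (mem_range.2 (by lia))) _

theorem IsBCHDenominator.mul {s D : ℕ} (h : IsBCHDenominator s D) {m : ℕ} (hm : 0 < m) :
    IsBCHDenominator s (D * m) :=
  ⟨Nat.mul_pos h.1 hm, fun k hk ↦ Dvd.dvd.mul_right (h.2 k hk) m⟩

theorem IsBCHDenominator.exists_int_inv_factorial {s D : ℕ} (h : IsBCHDenominator s D) {k : ℕ}
    (hk : k ≤ s) : ∃ z : ℤ, (k.factorial : ℝ)⁻¹ * D = z := by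
  obtain ⟨m, hm⟩ : k.factorial ∣ D :=
    (Nat.factorial_dvd_factorial hk).trans (dvd_of_mul_left_dvd (h.2 0 (Nat.zero_le _)))
  refine ⟨m, ?_⟩
  have : (k.factorial : ℝ) ≠ 0 := by positivity
  rw [hm]
  push_cast
  field_simp

theorem IsBCHDenominator.exists_int_dexpInvCoeff {s D : ℕ} (h : IsBCHDenominator s D) {k n : ℕ}
    (hk : k ≤ s) (hn : n + 1 ≤ s) :
    ∃ z : ℤ, ((n : ℝ) + 1)⁻¹ * dexpInvCoeff k * D = z := by
  obtain ⟨m, hm⟩ := (Nat.mul_dvd_mul_left _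
    (Nat.dvd_factorial (Nat.succ_pos n) hn)).trans (h.2 k hk)
  refine ⟨(dexpInvCoeff k).num * m, ?_⟩
  have h1 : ((dexpInvCoeff k).den : ℝ) ≠ 0 := by exact_mod_cast (dexpInvCoeff k).den_nz
  have h2 : (dexpInvCoeff k : ℝ) * (dexpInvCoeff k).den = (dexpInvCoeff k).num := by
    exact_mod_cast Rat.mul_den_eq_num (dexpInvCoeff k)
  rw [hm]
  push_cast
  rw [← h2]
  have : (n : ℝ) + 1 ≠ 0 := by positivity
  field_simp

end Denominators

/-! ### Integrality of the BCH product and of `exp (ad x) y` -/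

section Integrality

variable {L : Type*} [LieRing L] [LieAlgebra ℝ L] {s D : ℕ} {T : ℕ → AddSubgroup L}

theorem int_smul_mem {A : AddSubgroup L} {x : L} (hx : x ∈ A) {r : ℝ} (hr : ∃ z : ℤ, r = z) :
    r • x ∈ A := by
  obtain ⟨z, rfl⟩ := hr
  rw [Int.cast_smul_eq_zsmul]
  exact zsmul_mem hx z

/-- Every entry of the bracket carries a factor `D`, whence `D ^ (k + 2)` for `k + 1` copies of the
curve and one `D • b`. Brackets of `b` with itself vanish, so every surviving term involves both `a`
and `b`. -/
theorem adPowCoeff_smul_mem (hT : IsLieFiltration T) {i j n : ℕ} (hi : 1 ≤ i) (hj : 1 ≤ j)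
    {a b : L} (ha : a ∈ T i) (hb : b ∈ T j) {c : ℕ → L}
    (hc : ∀ m ≤ n, ∃ r ∈ T (i + j),
      c m = (D : ℝ) • ((if m = 0 then a else 0) + (if m = 1 then b else 0) + r))
    (k : ℕ) : ∀ m ≤ n, ∃ r ∈ T (i + j),
      adPowCoeff c ((D : ℝ) • b) (k + 1) m = (D : ℝ) ^ (k + 2) • r := by
  induction k with
  | zero =>
    intro m hm
    obtain ⟨r, hr, h⟩ := hc m hm
    refine ⟨⁅(if m = 0 then a else 0) + (if m = 1 then b else 0) + r, b⁆, ?_, ?_⟩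
    · rw [add_lie, add_lie]
      refine add_mem (add_mem ?_ ?_) (hT.antitone (by lia) (hT.lie_mem hr hb))
      · split_ifs
        · exact hT.lie_mem ha hb
        · simp
      · split_ifs <;> simp
    · rw [adPowCoeff, sum_eq_single (m, 0)]
      · rw [h, adPowCoeff, if_pos rfl, smul_lie, lie_smul, smul_smul, zero_add, pow_two]
      · intro p hp hp0
        rw [adPowCoeff, if_neg, lie_zero]
        intro h0
        have := mem_antidiagonal.1 hp
        exact hp0 (Prod.ext (by simp; lia) h0)
      · intro hm'
        exact absurd (mem_antidiagonal.2 (add_zero m)) hm'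
  | succ k ih =>
    intro m hm
    have key : ∀ p ∈ antidiagonal m, ∃ r ∈ T (i + j),
        ⁅c p.1, adPowCoeff c ((D : ℝ) • b) (k + 1) p.2⁆ = (D : ℝ) ^ (k + 1 + 2) • r := by
      intro p hp
      have hp := mem_antidiagonal.1 hp
      obtain ⟨r, hr, h⟩ := hc p.1 (by lia)
      obtain ⟨r', hr', h'⟩ := ih p.2 (by lia)
      have hmem : (if p.1 = 0 then a else 0) + (if p.1 = 1 then b else 0) + r ∈ T 1 := by
        refine add_mem (add_mem ?_ ?_) (hT.antitone (by lia) hr)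
        · split_ifs
          · exact hT.antitone hi ha
          · simp
        · split_ifs
          · exact hT.antitone hj hb
          · simp
      refine ⟨_, hT.antitone (by lia) (hT.lie_mem hmem hr'), ?_⟩
      rw [h, h', smul_lie, lie_smul, smul_smul]
      congr 1
      ring
    choose! f hf h using key
    refine ⟨∑ p ∈ antidiagonal m, f p, sum_mem fun p hp ↦ hf p hp, ?_⟩
    rw [adPowCoeff, smul_sum]
    exact sum_congr rfl fun p hp ↦ h p hp

theorem bchCoeff_smul_mem (hD : IsBCHDenominator s D) (hT : IsLieFiltration T) {i j : ℕ}
    (hi : 1 ≤ i) (hj : 1 ≤ j) {a b : L} (ha : a ∈ T i) (hb : b ∈ T j) (n : ℕ) (hn : n ≤ s) :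
    ∃ r ∈ T (i + j), bchCoeff s ((D : ℝ) • a) ((D : ℝ) • b) n
      = (D : ℝ) • ((if n = 0 then a else 0) + (if n = 1 then b else 0) + r) := by
  induction n using Nat.strong_induction_on with
  | _ n ih =>
    rcases n with _ | n
    · exact ⟨0, zero_mem _, by simp [bchCoeff_zero]⟩
    · choose! f hf h using adPowCoeff_smul_mem hT hi hj ha hb
        (c := bchCoeff s ((D : ℝ) • a) ((D : ℝ) • b)) (n := n)
        (fun m hm ↦ ih m (by lia) (by lia))
      -- Of the factor `D ^ (k + 2)`, one `D` stays outside, one clears the denominator, and `D ^ k`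
      -- is left over. The term without brackets is split off: it is `D • b` and occurs only for `n
      -- = 0`.
      refine ⟨∑ k ∈ range s, (((n : ℝ) + 1)⁻¹ * dexpInvCoeff (k + 1) * D * (D : ℝ) ^ k) • f k n,
        sum_mem fun k hk ↦ int_smul_mem (hf k n le_rfl) ?_, ?_⟩
      · obtain ⟨z, hz⟩ := hD.exists_int_dexpInvCoeff (mem_range.1 hk) hn
        exact ⟨z * D ^ k, by rw [hz]; push_cast; rfl⟩
      · rw [bchCoeff_succ, sum_range_succ']
        simp only [h _ n le_rfl]
        rw [if_neg (Nat.succ_ne_zero n), zero_add, smul_add, add_comm, smul_add, smul_sum,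
          smul_sum]
        congr 1
        · rw [dexpInvCoeff_zero, adPowCoeff]
          by_cases h0 : n = 0 <;> simp [h0]
        · refine sum_congr rfl fun k _ ↦ ?_
          rw [smul_smul, smul_smul, smul_smul]
          congr 1
          ring

theorem subsingleton_of_lcs_zero (hs : LieModule.lowerCentralSeries ℝ L L 0 = ⊥) (x : L) :
    x = 0 := by
  have : x ∈ LieModule.lowerCentralSeries ℝ L L 0 := by simp
  rwa [hs, LieSubmodule.mem_bot] at this

/-- The Baker–Campbell–Hausdorff product is the sum up to brackets, without denominators on
multiples of `D`. -/
theorem bch_smul_mem (hs : LieModule.lowerCentralSeries ℝ L L s = ⊥)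
    (hD : IsBCHDenominator s D) (hT : IsLieFiltration T) {i j : ℕ}
    (hi : 1 ≤ i) (hj : 1 ≤ j) {a b : L} (ha : a ∈ T i) (hb : b ∈ T j) :
    ∃ r ∈ T (i + j), bch s ((D : ℝ) • a) ((D : ℝ) • b) = (D : ℝ) • (a + b + r) := by
  rcases Nat.eq_zero_or_pos s with rfl | hs0
  · exact ⟨0, zero_mem _, by
      rw [subsingleton_of_lcs_zero hs (bch 0 _ _), subsingleton_of_lcs_zero hs (_ • _)]⟩
  choose! f hf h using bchCoeff_smul_mem hD hT hi hj ha hb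
  refine ⟨∑ n ∈ range (s + 1), f n,
    sum_mem fun n hn ↦ hf n (by simp at hn; lia), ?_⟩
  rw [bch, sum_congr rfl fun n hn ↦ h n (by simp at hn; lia), ← smul_sum, sum_add_distrib,
    sum_add_distrib, sum_ite_eq', sum_ite_eq', if_pos (by simp), if_pos (by simp; lia)]

/-- `exp (ad x) y` is `y + [x, y]` up to longer brackets, without denominators on multiples
of `D`. -/
theorem expAd_smul_mem (hs : LieModule.lowerCentralSeries ℝ L L s = ⊥)
    (hD : IsBCHDenominator s D) (hT : IsLieFiltration T) {i j : ℕ}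
    (hi : 1 ≤ i) {a b : L} (ha : a ∈ T i) (hb : b ∈ T j) :
    ∃ r ∈ T (i + j + 1), expAd s ((D : ℝ) • a) ((D : ℝ) • b)
      = (D : ℝ) • (b + (D : ℝ) • ⁅a, b⁆ + r) := by
  rcases Nat.eq_zero_or_pos s with rfl | hs0
  · exact ⟨0, zero_mem _, by
      rw [subsingleton_of_lcs_zero hs (expAd 0 _ _), subsingleton_of_lcs_zero hs (_ • _)]⟩
  have hpow : ∀ k, ((LieAlgebra.ad ℝ L ((D : ℝ) • a)) ^ k) ((D : ℝ) • b)
      = (D : ℝ) ^ (k + 1) • ((LieAlgebra.ad ℝ L a) ^ k) b := by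
    intro k
    rw [map_smul, map_smul, smul_pow, LinearMap.smul_apply, smul_smul, ← pow_succ']
  have hmem : ∀ k, ((LieAlgebra.ad ℝ L a) ^ k) b ∈ T (k * i + j) := by
    intro k
    induction k with
    | zero => simpa using hb
    | succ k ih =>
      rw [pow_succ', Module.End.mul_apply, LieAlgebra.ad_apply,
        show (k + 1) * i + j = i + (k * i + j) by ring]
      exact hT.lie_mem ha ih
  obtain ⟨s, rfl⟩ := Nat.exists_eq_add_of_le' hs0
  -- The terms with no bracket and one bracket are split off. In the others, of `D ^ (k + 3)` one
  -- factor stays outside and one clears `(k + 2)!`.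
  refine ⟨∑ k ∈ range s, (((k + 2).factorial : ℝ)⁻¹ * D * (D : ℝ) ^ (k + 1)) •
    ((LieAlgebra.ad ℝ L a) ^ (k + 2)) b, ?_, ?_⟩
  · refine sum_mem fun k hk ↦ int_smul_mem (hT.antitone (by nlinarith) (hmem (k + 2))) ?_
    obtain ⟨z, hz⟩ := hD.exists_int_inv_factorial (k := k + 2) (by simp at hk; lia)
    exact ⟨z * D ^ (k + 1), by rw [hz]; push_cast; rfl⟩
  · rw [expAd, sum_range_succ', sum_range_succ', smul_add, smul_add, smul_sum]
    simp only [hpow]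
    rw [add_comm, add_comm (∑ _ ∈ _, _), ← add_assoc]
    congr 1
    · simp [pow_two, smul_smul]
    · refine sum_congr rfl fun k _ ↦ ?_
      rw [smul_smul, smul_smul]
      congr 1
      ring

end Integrality

/-! ### The Lie ring generated by a set and its lower central filtration -/

section LieRingClosure

variable {L : Type*} [LieRing L]

theorem lie_mem_of_mem_closure_left {S : Set L} {B : AddSubgroup L} {x y : L}
    (h : ∀ x ∈ S, ⁅x, y⁆ ∈ B) (hx : x ∈ AddSubgroup.closure S) : ⁅x, y⁆ ∈ B := by
  induction hx using AddSubgroup.closure_induction with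
  | mem x hx => exact h x hx
  | zero => simp
  | add a b _ _ ha hb => rw [add_lie]; exact add_mem ha hb
  | neg a _ ha => rw [neg_lie]; exact neg_mem ha

theorem lie_mem_of_mem_closure {S S' : Set L} {B : AddSubgroup L} {x y : L}
    (h : ∀ x ∈ S, ∀ y ∈ S', ⁅x, y⁆ ∈ B) (hx : x ∈ AddSubgroup.closure S)
    (hy : y ∈ AddSubgroup.closure S') : ⁅x, y⁆ ∈ B := by
  refine lie_mem_of_mem_closure_left (fun x hx ↦ ?_) hx
  rw [← lie_skew]
  exact neg_mem (lie_mem_of_mem_closure_left (fun y hy ↦ by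
    rw [← lie_skew]; exact neg_mem (h x hx y hy)) hy)

/-- The additive subgroup generated by the `n + 1`-fold left-normed brackets of elements
of `A`. -/
def leftBracketSpan (A : Set L) : ℕ → AddSubgroup L
  | 0 => AddSubgroup.closure A
  | n + 1 => AddSubgroup.closure {z | ∃ a ∈ A, ∃ v ∈ leftBracketSpan A n, z = ⁅a, v⁆}

/-- By the Jacobi identity, left-normed brackets already span everything obtained by bracketing. -/
theorem lie_mem_leftBracketSpan {A : Set L} {i j : ℕ} {x y : L} (hx : x ∈ leftBracketSpan A i)
    (hy : y ∈ leftBracketSpan A j) : ⁅x, y⁆ ∈ leftBracketSpan A (i + j + 1) := by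
  have hgen : ∀ {a v : L} {n : ℕ}, a ∈ A → v ∈ leftBracketSpan A n →
      ⁅a, v⁆ ∈ leftBracketSpan A (n + 1) := fun ha hv ↦
    AddSubgroup.subset_closure ⟨_, ha, _, hv, rfl⟩
  induction i generalizing x y j with
  | zero =>
    rw [zero_add]
    exact lie_mem_of_mem_closure_left (fun a ha ↦ hgen ha hy) hx
  | succ i ih =>
    refine lie_mem_of_mem_closure_left ?_ hx
    rintro _ ⟨a, ha, v, hv, rfl⟩
    have h1 := hgen ha (ih hv hy)
    have h2 := ih hv (hgen ha hy)
    rw [show i + (j + 1) + 1 = i + j + 1 + 1 by ring] at h2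
    rw [lie_lie, show i + 1 + j + 1 = i + j + 1 + 1 by ring]
    exact sub_mem h1 h2

/-- The lower central series of the Lie ring generated by `A`. -/
def bracketFiltration (A : Set L) (k : ℕ) : AddSubgroup L :=
  AddSubgroup.closure {z | ∃ m, k ≤ m + 1 ∧ z ∈ leftBracketSpan A m}

theorem leftBracketSpan_le (A : Set L) {k m : ℕ} (h : k ≤ m + 1) :
    leftBracketSpan A m ≤ bracketFiltration A k :=
  fun _ hz ↦ AddSubgroup.subset_closure ⟨m, h, hz⟩

theorem isLieFiltration_bracketFiltration (A : Set L) :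
    IsLieFiltration (bracketFiltration A) where
  antitone i j hij := AddSubgroup.closure_mono fun z ⟨m, hm, hz⟩ ↦ ⟨m, hij.trans hm, hz⟩
  lie_mem {i j x y} hx hy := by
    refine lie_mem_of_mem_closure ?_ hx hy
    rintro x ⟨m, hm, hx⟩ y ⟨n, hn, hy⟩
    exact leftBracketSpan_le A (by lia) (lie_mem_leftBracketSpan hx hy)

theorem exists_sub_mem_bracketFiltration {A : Set L} {n : ℕ} {z : L}
    (hz : z ∈ bracketFiltration A (n + 1)) :
    ∃ v ∈ leftBracketSpan A n, z - v ∈ bracketFiltration A (n + 2) := by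
  induction hz using AddSubgroup.closure_induction with
  | mem z hz =>
    obtain ⟨m, hm, hz⟩ := hz
    rcases (show n = m ∨ n + 2 ≤ m + 1 by lia) with rfl | h
    · exact ⟨z, hz, by simp⟩
    · exact ⟨0, zero_mem _, by simpa using leftBracketSpan_le A h hz⟩
  | zero => exact ⟨0, zero_mem _, by simp⟩
  | add a b _ _ ha hb =>
    obtain ⟨v, hv, h⟩ := ha
    obtain ⟨w, hw, h'⟩ := hb
    exact ⟨v + w, add_mem hv hw, by rw [add_sub_add_comm]; exact add_mem h h'⟩
  | neg a _ ha =>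
    obtain ⟨v, hv, h⟩ := ha
    exact ⟨-v, neg_mem hv, by rw [← neg_sub']; exact neg_mem h⟩

theorem spanZ_eq_closure (A : Set L) : spanZ A = AddSubgroup.closure A := by
  rw [spanZ, ← Submodule.coe_toAddSubgroup, Submodule.span_int_eq_addSubgroupClosure]

theorem subset_bracketClosure (A : Set L) : A ⊆ bracketClosure A :=
  Set.subset_sInter fun _ h ↦ h.1

theorem bracketClosed_bracketClosure (A : Set L) : BracketClosed (bracketClosure A) :=
  fun X hX Y hY B hB ↦ hB.2 X (hX B hB) Y (hY B hB)

theorem bracketClosed_closure {B : Set L} (hB : BracketClosed B) :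
    BracketClosed (AddSubgroup.closure B : Set L) := fun _ hX _ hY ↦
  lie_mem_of_mem_closure (fun x hx y hy ↦ AddSubgroup.subset_closure (hB x hx y hy)) hX hY

/-- Identifies the set in the definition of `hPlus` with the generated Lie ring, to which the
filtration arguments apply. -/
theorem spanZ_bracketClosure_spanZ (A : Set L) :
    spanZ (bracketClosure (spanZ A)) = bracketFiltration A 1 := by
  rw [spanZ_eq_closure, spanZ_eq_closure]
  refine congrArg _ (le_antisymm ?_ ?_)
  · rw [AddSubgroup.closure_le]
    exact Set.sInter_subset_of_mem ⟨leftBracketSpan_le A (le_refl (0 + 1)), fun X hX Y hY ↦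
      (isLieFiltration_bracketFiltration A).antitone (by lia)
        ((isLieFiltration_bracketFiltration A).lie_mem hX hY)⟩
  · have hV : ∀ m, leftBracketSpan A m ≤
        AddSubgroup.closure (bracketClosure (AddSubgroup.closure A : Set L)) := by
      intro m
      induction m with
      | zero => exact (subset_bracketClosure _).trans AddSubgroup.subset_closure
      | succ m ih =>
        rw [leftBracketSpan, AddSubgroup.closure_le]
        rintro _ ⟨a, ha, v, hv, rfl⟩
        exact bracketClosed_closure (bracketClosed_bracketClosure _) a
          (AddSubgroup.subset_closure (subset_bracketClosure _ (AddSubgroup.subset_closure ha)))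
          v (ih hv)
    rw [bracketFiltration, AddSubgroup.closure_le]
    rintro z ⟨m, -, hz⟩
    exact hV m hz

end LieRingClosure

/-! ### Scaled filtrations and congruences modulo deeper terms -/

section Filtrations

variable {L : Type*} [LieRing L] [LieAlgebra ℝ L] {s D : ℕ} {T : ℕ → AddSubgroup L}

/-- Bracketing two elements of `m • T` produces `m ^ 2`; the spare `m` is harmless because it is an
integer. -/
theorem IsLieFiltration.smul (hT : IsLieFiltration T) (m : ℕ) :
    IsLieFiltration fun k ↦ (m : ℝ) • T k where
  antitone i j hij := by
    intro x hx
    obtain ⟨a, ha, rfl⟩ := AddSubgroup.mem_smul_pointwise_iff_exists _ _ _ |>.1 hx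
    exact AddSubgroup.smul_mem_pointwise_smul _ _ _ (hT.antitone hij ha)
  lie_mem {i j x y} hx hy := by
    obtain ⟨a, ha, rfl⟩ := AddSubgroup.mem_smul_pointwise_iff_exists _ _ _ |>.1 hx
    obtain ⟨b, hb, rfl⟩ := AddSubgroup.mem_smul_pointwise_iff_exists _ _ _ |>.1 hy
    rw [smul_lie, lie_smul]
    exact AddSubgroup.smul_mem_pointwise_smul _ _ _ (int_smul_mem (hT.lie_mem ha hb) ⟨m, by simp⟩)

theorem bch_sub_mem (hs : LieModule.lowerCentralSeries ℝ L L s = ⊥)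
    (hD : IsBCHDenominator s D) (hT : IsLieFiltration T) {i j : ℕ}
    (hi : 1 ≤ i) (hj : 1 ≤ j) {x y : L} (hx : x ∈ (D : ℝ) • T i) (hy : y ∈ (D : ℝ) • T j) :
    bch s x y - (x + y) ∈ (D : ℝ) • T (i + j) := by
  obtain ⟨a, ha, rfl⟩ := AddSubgroup.mem_smul_pointwise_iff_exists _ _ _ |>.1 hx
  obtain ⟨b, hb, rfl⟩ := AddSubgroup.mem_smul_pointwise_iff_exists _ _ _ |>.1 hy
  obtain ⟨r, hr, h⟩ := bch_smul_mem hs hD hT hi hj ha hb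
  rw [h, smul_add, smul_add, add_sub_cancel_left]
  exact AddSubgroup.smul_mem_pointwise_smul _ _ _ hr

theorem expAd_sub_mem (hs : LieModule.lowerCentralSeries ℝ L L s = ⊥)
    (hD : IsBCHDenominator s D) (hT : IsLieFiltration T) {i j : ℕ}
    (hi : 1 ≤ i) {x y : L} (hx : x ∈ (D : ℝ) • T i) (hy : y ∈ (D : ℝ) • T j) :
    expAd s x y - (y + ⁅x, y⁆) ∈ (D : ℝ) • T (i + j + 1) := by
  obtain ⟨a, ha, rfl⟩ := AddSubgroup.mem_smul_pointwise_iff_exists _ _ _ |>.1 hx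
  obtain ⟨b, hb, rfl⟩ := AddSubgroup.mem_smul_pointwise_iff_exists _ _ _ |>.1 hy
  obtain ⟨r, hr, h⟩ := expAd_smul_mem hs hD hT hi ha hb
  rw [h, smul_add, smul_add, smul_lie, lie_smul, add_sub_cancel_left]
  exact AddSubgroup.smul_mem_pointwise_smul _ _ _ hr

theorem IsLieFiltration.smul_antitone (hT : IsLieFiltration T) {i j : ℕ} (hij : i ≤ j) :
    (D : ℝ) • T j ≤ (D : ℝ) • T i := (hT.smul D).antitone hij

theorem leftBracketSpan_le_lcs (A : Set L) (n : ℕ) {z : L} (hz : z ∈ leftBracketSpan A n) :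
    z ∈ LieModule.lowerCentralSeries ℝ L L n := by
  induction n generalizing z with
  | zero => simp
  | succ n ih =>
    induction hz using AddSubgroup.closure_induction with
    | mem z hz =>
      obtain ⟨a, -, v, hv, rfl⟩ := hz
      rw [LieModule.lowerCentralSeries_succ]
      exact LieSubmodule.lie_mem_lie (LieSubmodule.mem_top _) (ih hv)
    | zero => simp
    | add a b _ _ ha hb => exact add_mem ha hb
    | neg a _ ha => exact neg_mem ha

theorem eq_zero_of_mem_bracketFiltration (hs : LieModule.lowerCentralSeries ℝ L L s = ⊥)
    {A : Set L} {k : ℕ} (hk : s < k) {z : L} (hz : z ∈ bracketFiltration A k) : z = 0 := by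
  induction hz using AddSubgroup.closure_induction with
  | mem z hz =>
    obtain ⟨m, hm, hz⟩ := hz
    have h := LieModule.antitone_lowerCentralSeries ℝ L L (show s ≤ m by lia)
      (leftBracketSpan_le_lcs A m hz)
    rwa [hs, LieSubmodule.mem_bot] at h
  | zero => rfl
  | add a b _ _ ha hb => rw [ha, hb, add_zero]
  | neg a _ ha => rw [ha, neg_zero]

end Filtrations

/-! ### From commutators in the group to brackets in the Lie ring -/

section Exponential

variable {L : Type*} [LieRing L] [LieAlgebra ℝ L] {G : Type*} [Group G]

/-- `e` behaves like the exponential map of a simply connected nilpotent Lie group. -/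
structure IsNilpotentExp (s : ℕ) (e : L ≃ G) : Prop where
  lcs : LieModule.lowerCentralSeries ℝ L L s = ⊥
  mul : ∀ x y, e x * e y = e (bch s x y)
  conj : ∀ x y, e x * e y * (e x)⁻¹ = e (expAd s x y)
  zpow : ∀ (n : ℤ) x, e (n • x) = e x ^ n

namespace IsNilpotentExp

variable {s D : ℕ} {e : L ≃ G} (h : IsNilpotentExp s e) {T : ℕ → AddSubgroup L}

theorem zero (h : IsNilpotentExp s e) : e 0 = 1 := by simpa using h.zpow 0 0

theorem neg (h : IsNilpotentExp s e) (x : L) : e (-x) = (e x)⁻¹ := by simpa using h.zpow (-1) x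

theorem nsmul (h : IsNilpotentExp s e) (n : ℕ) (x : L) : e ((n : ℝ) • x) = e x ^ n := by
  simpa [Nat.cast_smul_eq_nsmul] using h.zpow n x

/-- If `exp a * exp w = exp (a + z)` then `w` is `z` up to brackets. -/
theorem sub_mem_of_mul_eq (h : IsNilpotentExp s e) (hD : IsBCHDenominator s D)
    (hT : IsLieFiltration T) {i j : ℕ} (hi : 1 ≤ i) (hj : 1 ≤ j) {a z w : L}
    (ha : a ∈ (D : ℝ) • T i) (hz : z ∈ (D : ℝ) • T j) (hw : e a * e w = e (a + z)) :
    w - z ∈ (D : ℝ) • T (i + j) := by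
  have hbch : bch s a w = a + z := e.injective (by rw [← h.mul, hw])
  have hw' : w = bch s (-a) (a + z) := e.injective (by rw [← h.mul, ← hw, h.neg]; group)
  have ha1 := hT.smul_antitone (D := D) hi ha
  have hz1 := hT.smul_antitone (D := D) hj hz
  have hw1 : w ∈ (D : ℝ) • T 1 := by
    have h1 := bch_sub_mem h.lcs hD hT le_rfl le_rfl (neg_mem ha1) (add_mem ha1 hz1)
    rw [← hw', neg_add_cancel_left] at h1
    simpa using add_mem (hT.smul_antitone (D := D) (Nat.le_succ 1) h1) hz1
  -- Bootstrapping: knowing `w` at depth `k` makes it agree with `z` at depth `i + k`, so the known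
  -- depth of `w` grows until it reaches `j`.
  have step : ∀ k, 1 ≤ k → w ∈ (D : ℝ) • T k → w - z ∈ (D : ℝ) • T (i + k) := by
    intro k hk hwk
    have h1 := bch_sub_mem h.lcs hD hT hi hk ha hwk
    rw [hbch] at h1
    have := neg_mem h1
    rwa [show -(a + z - (a + w)) = w - z by abel] at this
  have iter : ∀ k, w ∈ (D : ℝ) • T (min j (k + 1)) := by
    intro k
    induction k with
    | zero => exact hT.smul_antitone (by lia) hw1
    | succ k ih =>
      have h1 := hT.smul_antitone (D := D) (show min j (k + 1 + 1) ≤ _ by lia)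
        (step _ (by lia) ih)
      simpa using add_mem h1 (hT.smul_antitone (D := D) (min_le_left j (k + 1 + 1)) hz)
  exact step j hj (by simpa using iter j)

/-- The group commutator is the bracket up to longer brackets. -/
theorem commutator_sub_mem (h : IsNilpotentExp s e) (hD : IsBCHDenominator s D)
    (hT : IsLieFiltration T) {i j : ℕ} (hi : 1 ≤ i) (hj : 1 ≤ j) {x y : L}
    (hx : x ∈ (D : ℝ) • T i) (hy : y ∈ (D : ℝ) • T j) :
    e.symm (e x * e y * (e x)⁻¹ * (e y)⁻¹) - ⁅x, y⁆ ∈ (D : ℝ) • T (i + j + 1) := by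
  set w := e.symm (e x * e y * (e x)⁻¹ * (e y)⁻¹)
  have hv := expAd_sub_mem h.lcs hD hT hi hx hy
  have hb : ⁅x, y⁆ ∈ (D : ℝ) • T (i + j) := (hT.smul D).lie_mem hx hy
  have hv' : expAd s x y - y ∈ (D : ℝ) • T (i + j) := by
    have := add_mem (hT.smul_antitone (D := D) (Nat.le_succ _) hv) hb
    rwa [show expAd s x y - (y + ⁅x, y⁆) + ⁅x, y⁆ = expAd s x y - y by abel] at this
  -- The conjugate of `exp y` by `exp x` is `exp (expAd s x y)`, so the commutator is a quotient of
  -- two elements whose logarithms differ at depth `i + j`. The quotient lemma then applies with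
  -- error at depth `j + (i + j)`, which is at least `i + j + 1`.
  have h1 : e (-y) * e (-w) = e (-y + -(expAd s x y - y)) := by
    rw [show -y + -(expAd s x y - y) = -expAd s x y by abel, h.neg, h.neg, h.neg, ← h.conj]
    simp only [w, Equiv.apply_symm_apply]
    group
  have h2 := neg_mem (h.sub_mem_of_mul_eq hD hT hj (by lia) (neg_mem hy) (neg_mem hv') h1)
  have h3 := add_mem (hT.smul_antitone (D := D) (show i + j + 1 ≤ _ by lia) h2) hv
  rwa [show -(-w - -(expAd s x y - y)) + (expAd s x y - (y + ⁅x, y⁆)) = w - ⁅x, y⁆ by abel] at h3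

/-- Multiplying an `(n + 1)`-fold bracket of elements of `D⁻¹ • log Γ` by `D ^ (n + 1)` gives a
bracket of logarithms of elements of `Γ`, which the iterated group commutator matches up to deeper
terms. Sums of such brackets are matched by products. -/
theorem exists_mem_sub_mem (h : IsNilpotentExp s e) (hD : IsBCHDenominator s D)
    (Γ : Subgroup G) (n : ℕ) {v : L}
    (hv : v ∈ leftBracketSpan ((D : ℝ)⁻¹ • e ⁻¹' (Γ : Set G)) n) :
    ∃ w, e w ∈ Γ ∧ w - (D : ℝ) ^ (n + 1) • v ∈
      (D : ℝ) • bracketFiltration ((D : ℝ)⁻¹ • e ⁻¹' (Γ : Set G)) (n + 2) := by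
  set A := (D : ℝ)⁻¹ • e ⁻¹' (Γ : Set G) with hA
  have hD0 : (D : ℝ) ≠ 0 := by exact_mod_cast hD.1.ne'
  have hT := isLieFiltration_bracketFiltration A
  have hmem : ∀ {n v w}, v ∈ leftBracketSpan A n →
      w - (D : ℝ) ^ (n + 1) • v ∈ (D : ℝ) • bracketFiltration A (n + 2) →
      w ∈ (D : ℝ) • bracketFiltration A (n + 1) := by
    intro n v w hv hw
    have h1 : (D : ℝ) ^ (n + 1) • v ∈ (D : ℝ) • bracketFiltration A (n + 1) := by
      rw [pow_succ', mul_smul]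
      exact AddSubgroup.smul_mem_pointwise_smul _ _ _ (int_smul_mem
        (leftBracketSpan_le A le_rfl hv) ⟨D ^ n, by simp⟩)
    simpa using add_mem (hT.smul_antitone (D := D) (Nat.le_succ _) hw) h1
  induction n generalizing v with
  | zero =>
    have hcl : v ∈ AddSubgroup.closure A := hv
    clear hv
    induction hcl using AddSubgroup.closure_induction with
    | mem v hv =>
      obtain ⟨γ, hγ, rfl⟩ := Set.mem_smul_set.1 hv
      exact ⟨γ, hγ, by simp [smul_smul, hD0]⟩
    | zero => exact ⟨0, by rw [h.zero]; exact one_mem _, by simp⟩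
    | add a b ha' hb' ha hb =>
      obtain ⟨v, hv, h1⟩ := ha
      obtain ⟨w, hw, h2⟩ := hb
      refine ⟨bch s v w, by rw [← h.mul]; exact mul_mem hv hw, ?_⟩
      have h3 := bch_sub_mem h.lcs hD hT (by lia) (by lia) (hmem (n := 0) ha' h1)
        (hmem (n := 0) hb' h2)
      have h4 := add_mem h3 (add_mem h1 h2)
      rw [smul_add]
      convert h4 using 1
      abel
    | neg a _ ha =>
      obtain ⟨v, hv, h1⟩ := ha
      exact ⟨-v, by rw [h.neg]; exact inv_mem hv, by
        rw [smul_neg, ← neg_sub']; exact neg_mem h1⟩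
  | succ n ih =>
    have hcl : v ∈ AddSubgroup.closure {z | ∃ a ∈ A, ∃ v ∈ leftBracketSpan A n, z = ⁅a, v⁆} := hv
    clear hv
    induction hcl using AddSubgroup.closure_induction with
    | mem v hv =>
      obtain ⟨a, ha, v, hv, rfl⟩ := hv
      obtain ⟨γ, hγ, rfl⟩ := Set.mem_smul_set.1 ha
      obtain ⟨w, hw, hwv⟩ := ih hv
      have hγ1 : γ ∈ (D : ℝ) • bracketFiltration A 1 := by
        rw [show γ = (D : ℝ) • (D : ℝ)⁻¹ • γ by simp [smul_smul, hD0]]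
        exact AddSubgroup.smul_mem_pointwise_smul _ _ _
          (leftBracketSpan_le A (le_refl (0 + 1)) (AddSubgroup.subset_closure ha))
      refine ⟨e.symm (e γ * e w * (e γ)⁻¹ * (e w)⁻¹), ?_, ?_⟩
      · rw [Equiv.apply_symm_apply]
        exact mul_mem (mul_mem (mul_mem hγ hw) (inv_mem hγ)) (inv_mem hw)
      · have h1 := h.commutator_sub_mem hD hT le_rfl (by lia) hγ1 (hmem hv hwv)
        have h2 := (hT.smul D).lie_mem hγ1 hwv
        have h3 := add_mem (hT.smul_antitone (D := D) (show n + 1 + 2 ≤ _ by lia) h1)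
          (hT.smul_antitone (D := D) (show n + 1 + 2 ≤ _ by lia) h2)
        rw [lie_sub, lie_smul, sub_add_sub_cancel] at h3
        rwa [smul_lie, smul_smul, show (D : ℝ) ^ (n + 1 + 1) * (D : ℝ)⁻¹ = (D : ℝ) ^ (n + 1) by
          rw [pow_succ, mul_assoc, mul_inv_cancel₀ hD0, mul_one]]
    | zero => exact ⟨0, by rw [h.zero]; exact one_mem _, by simp⟩
    | add a b ha' hb' ha hb =>
      obtain ⟨v, hv, h1⟩ := ha
      obtain ⟨w, hw, h2⟩ := hb
      refine ⟨bch s v w, by rw [← h.mul]; exact mul_mem hv hw, ?_⟩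
      have h3 := bch_sub_mem h.lcs hD hT (by lia) (by lia) (hmem (n := n + 1) ha' h1)
        (hmem (n := n + 1) hb' h2)
      have h4 := add_mem (hT.smul_antitone (D := D) (show n + 1 + 2 ≤ _ by lia) h3)
        (add_mem h1 h2)
      rw [smul_add]
      convert h4 using 1
      abel
    | neg a _ ha =>
      obtain ⟨v, hv, h1⟩ := ha
      exact ⟨-v, by rw [h.neg]; exact inv_mem hv, by
        rw [smul_neg, ← neg_sub']; exact neg_mem h1⟩

end IsNilpotentExp

universe v w

/-- Bounded multiples of the Lie ring generated by `(1 / D) • log Γ` lie in `log Γ`. -/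
theorem exists_smul_mem_of_mem_bracketFiltration {s D : ℕ} (hD : IsBCHDenominator s D) (i : ℕ) :
    ∀ n, s ≤ n + i → ∃ C : ℕ, 0 < C ∧
    ∀ (L : Type v) [LieRing L] [LieAlgebra ℝ L] (G : Type w) [Group G] (e : L ≃ G),
      IsNilpotentExp s e → ∀ (Γ : Subgroup G),
      ∀ z ∈ (D : ℝ) • bracketFiltration ((D : ℝ)⁻¹ • e ⁻¹' (Γ : Set G)) (n + 1),
        e ((C : ℝ) • z) ∈ Γ := by
  induction i with
  | zero =>
    intro n hn
    refine ⟨1, one_pos, fun L _ _ G _ e h Γ z hz ↦ ?_⟩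
    obtain ⟨t, ht, rfl⟩ := AddSubgroup.mem_smul_pointwise_iff_exists _ _ _ |>.1 hz
    rw [eq_zero_of_mem_bracketFiltration h.lcs (by lia) ht]
    simp [h.zero, one_mem]
  | succ i ih =>
    -- Descending induction on the depth `n + 1`, with `i` bounding the distance from `n` to `s`.
    intro n hn
    obtain ⟨m, hm, hC⟩ := ih (n + 1) (by lia)
    refine ⟨m * D ^ n, Nat.mul_pos hm (pow_pos hD.1 n), fun L _ _ G _ e h Γ z hz ↦ ?_⟩
    obtain ⟨t, ht, rfl⟩ := AddSubgroup.mem_smul_pointwise_iff_exists _ _ _ |>.1 hz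
    set A := (D : ℝ)⁻¹ • e ⁻¹' (Γ : Set G) with hA
    have hT := isLieFiltration_bracketFiltration A
    obtain ⟨v, hv, hvt⟩ := exists_sub_mem_bracketFiltration ht
    obtain ⟨w, hw, hwv⟩ := h.exists_mem_sub_mem hD Γ n hv
    -- `w` is the approximation by an element of `log Γ`, and `r` is the error, one level deeper.
    set r := (D : ℝ) ^ n • (D : ℝ) • t - w with hr
    have hr' : r ∈ (D : ℝ) • bracketFiltration A (n + 2) := by
      have h1 : (D : ℝ) ^ (n + 1) • (t - v) ∈ (D : ℝ) • bracketFiltration A (n + 2) := by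
        rw [pow_succ', mul_smul]
        exact AddSubgroup.smul_mem_pointwise_smul _ _ _ (int_smul_mem hvt ⟨D ^ n, by simp⟩)
      have h2 := sub_mem h1 hwv
      rwa [smul_sub, sub_sub_sub_cancel_right, pow_succ, mul_smul] at h2
    have hwS : w ∈ (D : ℝ) • bracketFiltration A (n + 1) := by
      have h1 : (D : ℝ) ^ n • (D : ℝ) • t ∈ (D : ℝ) • bracketFiltration A (n + 1) :=
        int_smul_mem (AddSubgroup.smul_mem_pointwise_smul _ _ _ ht) ⟨D ^ n, by simp⟩
      have h2 := sub_mem h1 (hT.smul_antitone (D := D) (Nat.le_succ _) hr')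
      rwa [hr, sub_sub_cancel] at h2
    -- After multiplication by `m`, the error in additive form is traded for a right factor `exp u`.
    -- Using the filtration `m • F` rather than `F` shows that `u` is itself `m` times an element of
    -- `D • F (n + 2)`, so that induction puts `exp u` in `Γ`.
    set u := e.symm ((e ((m : ℝ) • w))⁻¹ * e ((m : ℝ) • w + (m : ℝ) • r)) with hu
    have hu1 : e ((m : ℝ) • w) * e u = e ((m : ℝ) • w + (m : ℝ) • r) := by
      rw [hu, Equiv.apply_symm_apply, mul_inv_cancel_left]
    have hsm : ∀ {k} {x : L}, x ∈ (D : ℝ) • bracketFiltration A k →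
        (m : ℝ) • x ∈ (D : ℝ) • (m : ℝ) • bracketFiltration A k := by
      intro k x hx
      obtain ⟨y, hy, rfl⟩ := AddSubgroup.mem_smul_pointwise_iff_exists _ _ _ |>.1 hx
      rw [smul_comm]
      exact AddSubgroup.smul_mem_pointwise_smul _ _ _ (AddSubgroup.smul_mem_pointwise_smul _ _ _ hy)
    have hu2 := h.sub_mem_of_mul_eq hD (hT.smul m) (Nat.le_add_left 1 n)
      (Nat.le_add_left 1 (n + 1)) (hsm hwS) (hsm hr') hu1
    have hu3 : u ∈ (D : ℝ) • (m : ℝ) • bracketFiltration A (n + 2) := by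
      simpa using add_mem ((hT.smul m).smul_antitone (D := D) (show n + 2 ≤ _ by lia) hu2)
        (hsm hr')
    have hu4 : e u ∈ Γ := by
      obtain ⟨y, hy, hyu⟩ := AddSubgroup.mem_smul_pointwise_iff_exists _ _ _ |>.1 hu3
      obtain ⟨y', hy', rfl⟩ := AddSubgroup.mem_smul_pointwise_iff_exists _ _ _ |>.1 hy
      rw [← hyu, smul_comm]
      exact hC L G e h Γ _ (AddSubgroup.smul_mem_pointwise_smul _ _ _ hy')
    have hfin : ((m * D ^ n : ℕ) : ℝ) • (D : ℝ) • t = (m : ℝ) • w + (m : ℝ) • r := by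
      rw [hr, ← smul_add, add_sub_cancel]
      push_cast
      rw [mul_smul]
    rw [hfin, ← hu1, h.nsmul]
    exact mul_mem (pow_mem hw m) hu4

end Exponential

/-! ### The theorem for an abstract exponential map -/

section Harmonious

universe v w

variable {L : Type v} [LieRing L]

theorem isLieFiltration_const {B : AddSubgroup L} (hB : BracketClosed (B : Set L)) :
    IsLieFiltration fun _ : ℕ ↦ B where
  antitone _ _ _ := le_rfl
  lie_mem hx hy := hB _ hx _ hy

variable [LieAlgebra ℝ L]

theorem smul_spanZ (r : ℝ) (A : Set L) : r • spanZ A = spanZ (r • A) := by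
  rw [spanZ_eq_closure, spanZ_eq_closure, ← AddSubgroup.coe_pointwise_smul]
  congr 1
  exact (DistribSMul.toAddMonoidHom L r).map_closure A

theorem IsNilpotentExp.exists_subgroup {G : Type w} [Group G] {s D : ℕ} {e : L ≃ G}
    (h : IsNilpotentExp s e) (hD : IsBCHDenominator s D) {B : AddSubgroup L}
    (hB : BracketClosed (B : Set L)) :
    ∃ H : Subgroup G, e ⁻¹' (H : Set G) = (D : ℝ) • (B : Set L) := by
  refine ⟨{ carrier := e.symm ⁻¹' ((D : ℝ) • (B : Set L))
            mul_mem' := ?_, one_mem' := ?_, inv_mem' := ?_ }, ?_⟩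
  · intro x y hx hy
    rw [Set.mem_preimage, ← AddSubgroup.coe_pointwise_smul, SetLike.mem_coe] at *
    have h1 := bch_sub_mem h.lcs hD (isLieFiltration_const hB) le_rfl le_rfl hx hy
    have h2 : e.symm (x * y) = bch s (e.symm x) (e.symm y) := by
      rw [Equiv.symm_apply_eq, ← h.mul, Equiv.apply_symm_apply, Equiv.apply_symm_apply]
    rw [h2]
    simpa using add_mem h1 (add_mem hx hy)
  · rw [Set.mem_preimage, ← h.zero, Equiv.symm_apply_apply, ← AddSubgroup.coe_pointwise_smul]
    exact zero_mem _
  · intro x hx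
    rw [Set.mem_preimage, ← AddSubgroup.coe_pointwise_smul, SetLike.mem_coe] at *
    have h2 : e.symm x⁻¹ = -e.symm x := by
      rw [Equiv.symm_apply_eq, h.neg, Equiv.apply_symm_apply]
    rw [h2]
    exact neg_mem hx
  · ext x
    simp

theorem bracketClosed_smul {B : AddSubgroup L} (hB : BracketClosed (B : Set L)) (D : ℕ) :
    BracketClosed ((D : ℝ) • (B : Set L)) := fun _ hX _ hY ↦
  ((isLieFiltration_const hB).smul D).lie_mem (i := 0) (j := 0) hX hY

/-- The theorem on harmonious subgroups, for an abstract exponential map. -/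
theorem exists_harmonious_constants (s : ℕ) : ∃ C₁ C₂ : ℕ, 0 < C₁ ∧ 0 < C₂ ∧
    ∀ (L : Type v) [LieRing L] [LieAlgebra ℝ L] (G : Type w) [Group G] (e : L ≃ G),
      IsNilpotentExp s e → ∀ (Γ : Subgroup G) (A P M : Set L), A = e ⁻¹' (Γ : Set G) →
      M = (C₁ : ℝ) • spanZ A →
      P = (C₁ : ℝ) • spanZ (bracketClosure ((1 / (C₁ : ℝ)) • spanZ A)) →
      ((∃ H : Subgroup G, e ⁻¹' (H : Set G) = M) ∧ (∃ Λ : AddSubgroup L, (Λ : Set L) = M) ∧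
        BracketClosed M) ∧
      ((∃ H : Subgroup G, e ⁻¹' (H : Set G) = P) ∧ (∃ Λ : AddSubgroup L, (Λ : Set L) = P) ∧
        BracketClosed P) ∧
      (C₁ : ℝ) • A ⊆ M ∧ M ⊆ A ∧ A ⊆ P ∧ P ⊆ (1 / (C₂ : ℝ)) • A := by
  obtain ⟨D, hD⟩ := exists_isBCHDenominator s
  obtain ⟨C, hC, hCΓ⟩ := exists_smul_mem_of_mem_bracketFiltration.{v, w} hD s 0 (by lia)
  -- The same result with `D * C` as denominator, since the Lie ring behind `H₊` is generated by `(D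
  -- * C)⁻¹ • log Γ`.
  obtain ⟨C₂, hC₂, hC₂Γ⟩ :=
    exists_smul_mem_of_mem_bracketFiltration.{v, w} (hD.mul hC) s 0 (by lia)
  refine ⟨D * C, C₂, Nat.mul_pos hD.1 hC, hC₂, ?_⟩
  rintro L _ _ G _ e h Γ A P M hA rfl hP
  have hD0 : (D : ℝ) ≠ 0 := by exact_mod_cast hD.1.ne'
  have hC0 : (C : ℝ) ≠ 0 := by exact_mod_cast hC.ne'
  have hC₂0 : (C₂ : ℝ) ≠ 0 := by exact_mod_cast hC₂.ne'
  have hDC : ((D * C : ℕ) : ℝ) ≠ 0 := by exact_mod_cast (Nat.mul_pos hD.1 hC).ne'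
  replace hCΓ := hCΓ L G e h Γ
  replace hC₂Γ := hC₂Γ L G e h Γ
  rw [← hA, zero_add] at hCΓ hC₂Γ
  have hsub : ∀ {D : ℕ}, (D : ℝ) ≠ 0 → A ⊆ ((D : ℝ) • bracketFiltration ((D : ℝ)⁻¹ • A) 1 :
      AddSubgroup L) := by
    intro D hD x hx
    have h1 : (D : ℝ)⁻¹ • x ∈ bracketFiltration ((D : ℝ)⁻¹ • A) 1 :=
      leftBracketSpan_le _ (le_refl (0 + 1))
        (AddSubgroup.subset_closure (Set.smul_mem_smul_set hx))
    have h2 := AddSubgroup.smul_mem_pointwise_smul _ (D : ℝ) _ h1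
    rwa [smul_inv_smul₀ hD] at h2
  have hcl : AddSubgroup.closure A ≤ (D : ℝ) • bracketFiltration ((D : ℝ)⁻¹ • A) 1 :=
    (AddSubgroup.closure_le _).2 (hsub hD0)
  have hCA : ∀ z ∈ (D : ℝ) • bracketFiltration ((D : ℝ)⁻¹ • A) 1, (C : ℝ) • z ∈ A := by
    intro z hz
    rw [hA, Set.mem_preimage, SetLike.mem_coe]
    exact hCΓ z hz
  have hpow : ∀ (n : ℕ) {x : L}, x ∈ A → (n : ℝ) • x ∈ A := by
    intro n x hx
    rw [hA, Set.mem_preimage, SetLike.mem_coe] at hx ⊢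
    rw [h.nsmul]
    exact pow_mem hx n
  -- For `a, b ∈ A` the bracket lies in `D • F 1`, so `C • ⁅a, b⁆ ∈ A`. Thus one factor `C` of `⁅C •
  -- x, C • y⁆` returns the bracket to `span A` and the other remains outside.
  have hB : BracketClosed (((C : ℝ) • AddSubgroup.closure A : AddSubgroup L) : Set L) := by
    intro X hX Y hY
    rw [SetLike.mem_coe] at *
    obtain ⟨x, hx, rfl⟩ := AddSubgroup.mem_smul_pointwise_iff_exists _ _ _ |>.1 hX
    obtain ⟨y, hy, rfl⟩ := AddSubgroup.mem_smul_pointwise_iff_exists _ _ _ |>.1 hY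
    rw [smul_lie]
    refine AddSubgroup.smul_mem_pointwise_smul _ _ _ ?_
    rw [lie_smul]
    have hxy : ⁅x, y⁆ ∈ (C : ℝ)⁻¹ • AddSubgroup.closure A := by
      refine lie_mem_of_mem_closure (fun a ha b hb ↦ ?_) hx hy
      have hT := isLieFiltration_bracketFiltration ((D : ℝ)⁻¹ • A)
      have h1 := AddSubgroup.smul_mem_pointwise_smul _ (C : ℝ)⁻¹ _ (AddSubgroup.subset_closure
        (hCA _ (hT.smul_antitone (by lia) ((hT.smul D).lie_mem (hsub hD0 ha) (hsub hD0 hb)))))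
      rwa [inv_smul_smul₀ hC0] at h1
    have h1 := AddSubgroup.smul_mem_pointwise_smul _ (C : ℝ) _ hxy
    rwa [smul_inv_smul₀ hC0] at h1
  have hM : ((D * C : ℕ) : ℝ) • spanZ A
      = (D : ℝ) • (((C : ℝ) • AddSubgroup.closure A : AddSubgroup L) : Set L) := by
    rw [spanZ_eq_closure, AddSubgroup.coe_pointwise_smul, smul_smul, Nat.cast_mul]
  have hP' : P = ((D * C : ℕ) : ℝ) •
      ((bracketFiltration (((D * C : ℕ) : ℝ)⁻¹ • A) 1 : AddSubgroup L) : Set L) := by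
    rw [hP, smul_spanZ (1 / _), spanZ_bracketClosure_spanZ, one_div]
  have hT := isLieFiltration_bracketFiltration (((D * C : ℕ) : ℝ)⁻¹ • A)
  have hB' : BracketClosed (bracketFiltration (((D * C : ℕ) : ℝ)⁻¹ • A) 1 : Set L) :=
    fun X hX Y hY ↦ hT.antitone (by lia) (hT.lie_mem hX hY)
  refine ⟨⟨?_, ?_, ?_⟩, ⟨?_, ?_, ?_⟩, ?_, ?_, ?_, ?_⟩
  · rw [hM]; exact h.exists_subgroup hD hB
  · exact ⟨((D * C : ℕ) : ℝ) • AddSubgroup.closure A, by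
      rw [AddSubgroup.coe_pointwise_smul, spanZ_eq_closure]⟩
  · rw [hM]; exact bracketClosed_smul hB D
  · rw [hP']; exact h.exists_subgroup (hD.mul hC) hB'
  · exact ⟨_, by rw [hP', ← AddSubgroup.coe_pointwise_smul]⟩
  · rw [hP']; exact bracketClosed_smul hB' _
  · rw [spanZ_eq_closure]
    exact Set.smul_set_mono AddSubgroup.subset_closure
  · rw [spanZ_eq_closure]
    rintro _ ⟨x, hx, rfl⟩
    simp only [Nat.cast_mul, mul_smul]
    exact hpow D (hCA x (hcl hx))
  · rw [hP', ← AddSubgroup.coe_pointwise_smul]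
    exact hsub hDC
  · rw [hP', ← AddSubgroup.coe_pointwise_smul]
    intro z hz
    refine Set.mem_smul_set.2 ⟨(C₂ : ℝ) • z, ?_, by rw [one_div, inv_smul_smul₀ hC₂0]⟩
    rw [hA, Set.mem_preimage, SetLike.mem_coe]
    exact hC₂Γ z hz

end Harmonious

end NilLie

namespace NilLie

open Filter Topology

/-! ### The group law in the chart at the identity -/

section LocalGroup

variable (d : ℕ) (G : Type u) [TopologicalSpace G] [ChartedSpace (EuclideanSpace ℝ (Fin d)) G]
  [Group G]

/-- The preferred chart at the identity. -/
noncomputable abbrev oneChart : PartialEquiv G (EuclideanSpace ℝ (Fin d)) :=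
  extChartAt (𝓡 d) (1 : G)

/-- The coordinates of the identity. -/
noncomputable abbrev oneCoord : EuclideanSpace ℝ (Fin d) := oneChart d G 1

/-- Multiplication in the chart at the identity. -/
noncomputable def chartMul (p : EuclideanSpace ℝ (Fin d) × EuclideanSpace ℝ (Fin d)) :
    EuclideanSpace ℝ (Fin d) :=
  oneChart d G ((oneChart d G).symm p.1 * (oneChart d G).symm p.2)

theorem oneChart_symm_oneCoord : (oneChart d G).symm (oneCoord d G) = 1 :=
  extChartAt_to_inv (1 : G)

variable [LieGroup (𝓡 d) ∞ G]

instance : IsManifold (𝓡 d) 1 G := IsManifold.of_le (n := ∞) (by simp)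

/-- The identification of the Lie algebra with the model space. -/
noncomputable def toModel : LieAlg d G ≃ₗ[ℝ] EuclideanSpace ℝ (Fin d) where
  toFun v := v
  invFun v := v
  map_add' _ _ := rfl
  map_smul' _ _ := rfl
  left_inv _ := rfl
  right_inv _ := rfl

theorem contDiffAt_chartMul : ContDiffAt ℝ ∞ (chartMul d G) (oneCoord d G, oneCoord d G) := by
  have hsymm : ContMDiffAt 𝓘(ℝ, EuclideanSpace ℝ (Fin d)) (𝓡 d) ∞ (oneChart d G).symm
      (oneCoord d G) :=
    (contMDiffOn_extChartAt_symm (1 : G)).contMDiffAt (extChartAt_target_mem_nhds 1)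
  have h1 : ContMDiffAt (𝓘(ℝ, EuclideanSpace ℝ (Fin d) × EuclideanSpace ℝ (Fin d))) (𝓡 d) ∞
      (fun p : EuclideanSpace ℝ (Fin d) × EuclideanSpace ℝ (Fin d) ↦
        (oneChart d G).symm p.1 * (oneChart d G).symm p.2) (oneCoord d G, oneCoord d G) := by
    refine ContMDiffAt.mul ?_ ?_
    · exact ContMDiffAt.comp (I' := 𝓘(ℝ, EuclideanSpace ℝ (Fin d))) _ hsymm
        contDiffAt_fst.contMDiffAt
    · exact ContMDiffAt.comp (I' := 𝓘(ℝ, EuclideanSpace ℝ (Fin d))) _ hsymm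
        contDiffAt_snd.contMDiffAt
  have h2 : ContMDiffAt (𝓡 d) 𝓘(ℝ, EuclideanSpace ℝ (Fin d)) ∞ (oneChart d G) 1 :=
    contMDiffAt_extChartAt
  have h3 := ContMDiffAt.comp_of_eq (I' := 𝓡 d) h2 h1
    (by simp only [oneChart_symm_oneCoord, mul_one])
  exact h3.contDiffAt

variable {d G}

theorem mdifferentiableAt_mul_left (a b : G) :
    MDifferentiableAt (𝓡 d) (𝓡 d) (fun x : G ↦ a * x) b :=
  (contMDiff_mul_left (I := 𝓡 d) (n := ∞)).contMDiffAt.mdifferentiableAt (by simp)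

theorem mfderiv_oneChart_one (v : TangentSpace (𝓡 d) (1 : G)) :
    mfderiv (𝓡 d) 𝓘(ℝ, EuclideanSpace ℝ (Fin d)) (oneChart d G) 1 v = toModel d G v := by
  rw [mfderiv_extChartAt_self]
  rfl

theorem mfderiv_inv_mul_mulInvariantVectorField (X : LieAlg d G) (a : G) :
    (mfderiv (𝓡 d) (𝓡 d) (fun x : G ↦ a⁻¹ * x) a (mulInvariantVectorField X a) :
      EuclideanSpace ℝ (Fin d)) = toModel d G X := by
  have h := mfderiv_comp_apply_of_eq (I := 𝓡 d) (I' := 𝓡 d) (I'' := 𝓡 d) (x := (1 : G))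
      (y := a) (f := fun x : G ↦ a * x) (g := fun x : G ↦ a⁻¹ * x)
      (mdifferentiableAt_mul_left _ _) (mdifferentiableAt_mul_left _ _) (by simp) X
  have h1 : (fun x : G ↦ a⁻¹ * x) ∘ (fun x : G ↦ a * x) = id := by ext x; simp
  rw [h1, mfderiv_id] at h
  exact h.symm

theorem hasDerivAt_of_hasMFDerivAt {f : ℝ → EuclideanSpace ℝ (Fin d)} {t : ℝ}
    {f' : ℝ →L[ℝ] EuclideanSpace ℝ (Fin d)}
    (h : HasMFDerivAt 𝓘(ℝ, ℝ) 𝓘(ℝ, EuclideanSpace ℝ (Fin d)) f t f') :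
    HasDerivAt f (f' 1) t := by
  have h1 : HasFDerivAt f f' t := hasMFDerivAt_iff_hasFDerivAt.1 h
  exact h1.hasDerivAt

/-- With its converse below, this replaces integral curves of left-invariant fields by an ordinary
derivative in the single chart at the identity, after translating the curve back there. -/
theorem hasDerivAt_oneChart_of_hasMFDerivAt {γ : ℝ → G} {X : LieAlg d G} {t : ℝ}
    (h : HasMFDerivAt 𝓘(ℝ, ℝ) (𝓡 d) γ t
      ((1 : ℝ →L[ℝ] ℝ).smulRight (mulInvariantVectorField X (γ t)))) :
    HasDerivAt (fun τ ↦ oneChart d G ((γ t)⁻¹ * γ τ)) (toModel d G X) t := by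
  have h2 := (mdifferentiableAt_mul_left (γ t)⁻¹ (γ t)).hasMFDerivAt.comp t h
  have h3 : HasMFDerivAt (𝓡 d) 𝓘(ℝ, EuclideanSpace ℝ (Fin d)) (oneChart d G)
      (((fun x ↦ (γ t)⁻¹ * x) ∘ γ) t)
      (mfderiv (𝓡 d) 𝓘(ℝ, EuclideanSpace ℝ (Fin d)) (oneChart d G)
        (((fun x ↦ (γ t)⁻¹ * x) ∘ γ) t)) :=
    (mdifferentiableAt_extChartAt (by simp)).hasMFDerivAt
  have h4 := hasDerivAt_of_hasMFDerivAt (h3.comp t h2)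
  refine h4.congr_deriv ?_
  have h5 : ∀ b : G, b = 1 → ∀ v : EuclideanSpace ℝ (Fin d),
      (mfderiv (𝓡 d) 𝓘(ℝ, EuclideanSpace ℝ (Fin d)) (oneChart d G) b v :
        EuclideanSpace ℝ (Fin d)) = v := by
    rintro b rfl v
    exact mfderiv_oneChart_one v
  refine (h5 _ (by simp) _).trans ?_
  rw [← mfderiv_inv_mul_mulInvariantVectorField X (γ t)]
  exact congrArg (mfderiv (𝓡 d) (𝓡 d) (fun x : G ↦ (γ t)⁻¹ * x) (γ t))
    (one_smul ℝ (mulInvariantVectorField X (γ t)))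

theorem hasMFDerivAt_of_hasDerivAt_oneChart {γ : ℝ → G} {X : LieAlg d G} {t : ℝ}
    (hc : ContinuousAt γ t)
    (h : HasDerivAt (fun τ ↦ oneChart d G ((γ t)⁻¹ * γ τ)) (toModel d G X) t) :
    HasMFDerivAt 𝓘(ℝ, ℝ) (𝓡 d) γ t
      ((1 : ℝ →L[ℝ] ℝ).smulRight (mulInvariantVectorField X (γ t))) := by
  have := topologicalGroup_of_lieGroup (𝓡 d) ∞ (G := G)
  have h1 : ∀ y, y = oneCoord d G → ∃ A : EuclideanSpace ℝ (Fin d) →L[ℝ] EuclideanSpace ℝ (Fin d),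
      (∀ v, A v = v) ∧
      HasMFDerivAt 𝓘(ℝ, EuclideanSpace ℝ (Fin d)) (𝓡 d) (oneChart d G).symm y A := by
    rintro y rfl
    have h1 := ((mdifferentiableWithinAt_extChartAt_symm (I := 𝓡 d)
      (mem_extChartAt_target (I := 𝓡 d) (1 : G))).mdifferentiableAt (by simp)).hasMFDerivAt
    refine ⟨_, fun v ↦ ?_, h1⟩
    have h2 := mfderivWithin_range_extChartAt_symm (I := 𝓡 d) (x := (1 : G))
    rw [ModelWithCorners.range_eq_univ, mfderivWithin_univ] at h2
    exact congrArg (fun A : EuclideanSpace ℝ (Fin d) →L[ℝ] EuclideanSpace ℝ (Fin d) ↦ A v) h2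
  have h2 : HasMFDerivAt 𝓘(ℝ, ℝ) 𝓘(ℝ, EuclideanSpace ℝ (Fin d))
      (fun τ ↦ oneChart d G ((γ t)⁻¹ * γ τ)) t _ := h.hasFDerivAt.hasMFDerivAt
  have h0 : oneChart d G ((γ t)⁻¹ * γ t) = oneCoord d G := by rw [inv_mul_cancel]
  obtain ⟨A, hA, h3⟩ := h1 _ h0
  have h4 := (mdifferentiableAt_mul_left (d := d) (γ t) ((oneChart d G).symm
    (oneChart d G ((γ t)⁻¹ * γ t)))).hasMFDerivAt.comp t (h3.comp t h2)
  have h5 : γ =ᶠ[𝓝 t] (fun x ↦ γ t * x) ∘ (oneChart d G).symm ∘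
      fun τ ↦ oneChart d G ((γ t)⁻¹ * γ τ) := by
    have h6 : Tendsto (fun τ ↦ (γ t)⁻¹ * γ τ) (𝓝 t) (𝓝 1) := by
      simpa using (tendsto_const_nhds (x := (γ t)⁻¹)).mul hc.tendsto
    filter_upwards [h6 (extChartAt_source_mem_nhds (I := 𝓡 d) 1)] with τ hτ
    simp only [Function.comp]
    rw [(oneChart d G).left_inv hτ, mul_inv_cancel_left]
  refine (h4.congr_of_eventuallyEq h5).congr_mfderiv ?_
  have h7 : ∀ b : G, b = 1 → ∀ v : EuclideanSpace ℝ (Fin d),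
      (mfderiv (𝓡 d) (𝓡 d) (fun x : G ↦ γ t * x) b v : EuclideanSpace ℝ (Fin d)) =
      mfderiv (𝓡 d) (𝓡 d) (fun x : G ↦ γ t * x) 1 ((toModel d G).symm v) := by
    rintro b rfl v
    rfl
  refine ContinuousLinearMap.ext fun r : ℝ ↦ ?_
  refine (h7 ((oneChart d G).symm (oneChart d G ((γ t)⁻¹ * γ t)))
    (by rw [h0]; exact extChartAt_to_inv (1 : G)) (A (r • toModel d G X))).trans ?_
  rw [hA]
  exact map_smul (mfderiv (𝓡 d) (𝓡 d) (fun x : G ↦ γ t * x) 1) r X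

end LocalGroup

/-! ### The Lie bracket as a second derivative of multiplication -/

section Bracket

variable (d : ℕ) (G : Type u) [TopologicalSpace G] [ChartedSpace (EuclideanSpace ℝ (Fin d)) G]
  [Group G] [LieGroup (𝓡 d) ∞ G]

/-- The derivative of `y ↦ x * y` at the identity, in the chart at the identity. -/
noncomputable def rightDeriv (x : EuclideanSpace ℝ (Fin d)) :
    EuclideanSpace ℝ (Fin d) →L[ℝ] EuclideanSpace ℝ (Fin d) :=
  (fderiv ℝ (chartMul d G) (x, oneCoord d G)).comp (ContinuousLinearMap.inr ℝ _ _)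

/-- The derivative of `y ↦ y * x` at the identity, in the chart at the identity. -/
noncomputable def leftDeriv (x : EuclideanSpace ℝ (Fin d)) :
    EuclideanSpace ℝ (Fin d) →L[ℝ] EuclideanSpace ℝ (Fin d) :=
  (fderiv ℝ (chartMul d G) (oneCoord d G, x)).comp (ContinuousLinearMap.inl ℝ _ _)

theorem eventually_contDiffAt_chartMul :
    ∀ᶠ p in 𝓝 (oneCoord d G, oneCoord d G), ContDiffAt ℝ 3 (chartMul d G) p :=
  ((contDiffAt_chartMul d G).of_le (ENat.LEInfty.out)).eventually (by simp)

theorem contDiffAt_fderiv_chartMul :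
    ContDiffAt ℝ 2 (fderiv ℝ (chartMul d G)) (oneCoord d G, oneCoord d G) :=
  (contDiffAt_chartMul d G).fderiv_right (m := 2)
    (by rw [show (2 : WithTop ℕ∞) + 1 = 3 by norm_num]; exact ENat.LEInfty.out)

theorem contDiffAt_rightDeriv : ContDiffAt ℝ 2 (rightDeriv d G) (oneCoord d G) := by
  have h : ContDiffAt ℝ 2 (fun x ↦ fderiv ℝ (chartMul d G) (x, oneCoord d G)) (oneCoord d G) :=
    (contDiffAt_fderiv_chartMul d G).comp (oneCoord d G)
      (f := fun x ↦ (x, oneCoord d G)) (by fun_prop)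
  exact h.clm_comp contDiffAt_const

theorem contDiffAt_leftDeriv : ContDiffAt ℝ 2 (leftDeriv d G) (oneCoord d G) := by
  have h : ContDiffAt ℝ 2 (fun x ↦ fderiv ℝ (chartMul d G) (oneCoord d G, x)) (oneCoord d G) :=
    (contDiffAt_fderiv_chartMul d G).comp (oneCoord d G)
      (f := fun x ↦ (oneCoord d G, x)) (by fun_prop)
  exact h.clm_comp contDiffAt_const

/-- Expresses left-invariant fields in coordinates by differentiating `y ↦ x * y`, so that their
bracket becomes a derivative of `rightDeriv`. -/
theorem eventually_rightDeriv_eq :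
    ∀ᶠ x in 𝓝 (oneCoord d G), ∀ X : LieAlg d G,
      (VectorField.mpullbackWithin 𝓘(ℝ, EuclideanSpace ℝ (Fin d)) (𝓡 d) (oneChart d G).symm
        (mulInvariantVectorField X) (Set.range (𝓡 d)) x : EuclideanSpace ℝ (Fin d))
      = rightDeriv d G x (toModel d G X) := by
  have hc : Tendsto (fun x ↦ (x, oneCoord d G)) (𝓝 (oneCoord d G))
      (𝓝 (oneCoord d G, oneCoord d G)) :=
    Continuous.tendsto' (by fun_prop) _ _ rfl
  filter_upwards [extChartAt_target_mem_nhds (I := 𝓡 d) (1 : G),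
    hc (eventually_contDiffAt_chartMul d G)] with x hx hx' X
  replace hx' : ContDiffAt ℝ 3 (chartMul d G) (x, oneCoord d G) := hx'
  set g := (oneChart d G).symm x with hg
  have hgs : g ∈ (oneChart d G).source := (oneChart d G).map_target hx
  have h1 : HasMFDerivAt 𝓘(ℝ, EuclideanSpace ℝ (Fin d)) (𝓡 d) (oneChart d G).symm (oneCoord d G)
      (ContinuousLinearMap.id ℝ (EuclideanSpace ℝ (Fin d))) := by
    have h1 := ((mdifferentiableWithinAt_extChartAt_symm (I := 𝓡 d)
      (mem_extChartAt_target (I := 𝓡 d) (1 : G))).mdifferentiableAt (by simp)).hasMFDerivAt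
    have h2 := mfderivWithin_range_extChartAt_symm (I := 𝓡 d) (x := (1 : G))
    rw [ModelWithCorners.range_eq_univ, mfderivWithin_univ] at h2
    rw [h2] at h1
    exact h1
  have h2 : ∀ b : G, b = 1 → ∃ A : EuclideanSpace ℝ (Fin d) →L[ℝ] EuclideanSpace ℝ (Fin d),
      (A (toModel d G X) = mulInvariantVectorField X g) ∧
      HasMFDerivAt (𝓡 d) (𝓡 d) (fun y ↦ g * y) b A := by
    rintro b rfl
    exact ⟨_, rfl, (mdifferentiableAt_mul_left g 1).hasMFDerivAt⟩
  obtain ⟨A, hA, h2⟩ := h2 _ (oneChart_symm_oneCoord d G)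
  have h3 : ∀ b : G, b = g → HasMFDerivAt (𝓡 d) 𝓘(ℝ, EuclideanSpace ℝ (Fin d)) (oneChart d G) b
      (mfderiv (𝓡 d) 𝓘(ℝ, EuclideanSpace ℝ (Fin d)) (oneChart d G) g :
        EuclideanSpace ℝ (Fin d) →L[ℝ] EuclideanSpace ℝ (Fin d)) := by
    rintro b rfl
    exact (mdifferentiableAt_extChartAt (by simpa using hgs)).hasMFDerivAt
  have h4 := (h3 (g * (oneChart d G).symm (oneCoord d G))
    (by rw [oneChart_symm_oneCoord, mul_one])).comp (oneCoord d G)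
    (f := (fun y ↦ g * y) ∘ (oneChart d G).symm) (h2.comp _ h1)
  have h5 : HasFDerivAt (fun y ↦ chartMul d G (x, y)) _ (oneCoord d G) :=
    hasMFDerivAt_iff_hasFDerivAt.1 h4
  have h6 : HasFDerivAt (fun y ↦ chartMul d G (x, y)) (rightDeriv d G x) (oneCoord d G) :=
    (hx'.differentiableAt (by simp)).hasFDerivAt.comp (oneCoord d G)
      (hasFDerivAt_prodMk_right x (oneCoord d G))
  rw [h6.unique h5]
  have h7 : (mfderivWithin 𝓘(ℝ, EuclideanSpace ℝ (Fin d)) (𝓡 d) (oneChart d G).symm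
      (Set.range (𝓡 d)) x).inverse
      = mfderiv (𝓡 d) 𝓘(ℝ, EuclideanSpace ℝ (Fin d)) (oneChart d G) g :=
    ContinuousLinearMap.inverse_eq (mfderivWithin_extChartAt_symm_comp_mfderiv_extChartAt hx)
      (mfderiv_extChartAt_comp_mfderivWithin_extChartAt_symm hx)
  rw [VectorField.mpullbackWithin_apply, h7]
  exact (congrArg (mfderiv (𝓡 d) 𝓘(ℝ, EuclideanSpace ℝ (Fin d)) (oneChart d G) g) hA).symm

theorem rightDeriv_oneCoord (X : EuclideanSpace ℝ (Fin d)) :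
    rightDeriv d G (oneCoord d G) X = X := by
  have h : (fun y ↦ chartMul d G (oneCoord d G, y)) =ᶠ[𝓝 (oneCoord d G)] id := by
    filter_upwards [extChartAt_target_mem_nhds (I := 𝓡 d) (1 : G)] with y hy
    rw [chartMul, oneChart_symm_oneCoord, one_mul]
    exact (oneChart d G).right_inv hy
  have h6 : HasFDerivAt (fun y ↦ chartMul d G (oneCoord d G, y)) (rightDeriv d G (oneCoord d G))
      (oneCoord d G) :=
    ((contDiffAt_chartMul d G).differentiableAt (by simp)).hasFDerivAt.comp (oneCoord d G)
      (hasFDerivAt_prodMk_right (oneCoord d G) (oneCoord d G))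
  rw [(h6.congr_of_eventuallyEq h.symm).unique (hasFDerivAt_id _)]
  rfl

theorem leftDeriv_oneCoord (X : EuclideanSpace ℝ (Fin d)) :
    leftDeriv d G (oneCoord d G) X = X := by
  have h : (fun y ↦ chartMul d G (y, oneCoord d G)) =ᶠ[𝓝 (oneCoord d G)] id := by
    filter_upwards [extChartAt_target_mem_nhds (I := 𝓡 d) (1 : G)] with y hy
    rw [chartMul, oneChart_symm_oneCoord, mul_one]
    exact (oneChart d G).right_inv hy
  have h6 : HasFDerivAt (fun y ↦ chartMul d G (y, oneCoord d G)) (leftDeriv d G (oneCoord d G))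
      (oneCoord d G) :=
    ((contDiffAt_chartMul d G).differentiableAt (by simp)).hasFDerivAt.comp (oneCoord d G)
      (f := fun e ↦ (e, oneCoord d G)) (hasFDerivAt_prodMk_left (oneCoord d G) (oneCoord d G))
  rw [(h6.congr_of_eventuallyEq h.symm).unique (hasFDerivAt_id _)]
  rfl

/-- The bracket in the chart at the identity. -/
theorem toModel_lie (X Z : LieAlg d G) : toModel d G ⁅X, Z⁆ =
    fderiv ℝ (rightDeriv d G) (oneCoord d G) (toModel d G X) (toModel d G Z)
      - fderiv ℝ (rightDeriv d G) (oneCoord d G) (toModel d G Z) (toModel d G X) := by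
  let V : LieAlg d G → EuclideanSpace ℝ (Fin d) → EuclideanSpace ℝ (Fin d) := fun X x ↦
    VectorField.mpullbackWithin 𝓘(ℝ, EuclideanSpace ℝ (Fin d)) (𝓡 d)
      (oneChart d G).symm (mulInvariantVectorField X) (Set.range (𝓡 d)) x
  have hV : ∀ X, V X =ᶠ[𝓝 (oneCoord d G)] fun x ↦ rightDeriv d G x (toModel d G X) := fun X ↦
    (eventually_rightDeriv_eq d G).mono fun x hx ↦ hx X
  have h2 : toModel d G ⁅X, Z⁆ = VectorField.lieBracket ℝ (V X) (V Z) (oneCoord d G) := by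
    rw [← VectorField.lieBracketWithin_univ]
    have h2 := VectorField.mlieBracketWithin_apply (I := 𝓡 d) (x₀ := (1 : G)) (s := Set.univ)
      (V := mulInvariantVectorField X) (W := mulInvariantVectorField Z)
    rw [mfderiv_extChartAt_self] at h2
    have h4 : ∀ v, (ContinuousLinearMap.id ℝ (EuclideanSpace ℝ (Fin d))).inverse v = v := by
      intro v
      rw [ContinuousLinearMap.inverse_id]
      rfl
    have h3 : (extChartAt (𝓡 d) (1 : G)).symm ⁻¹' Set.univ ∩ Set.range (𝓡 d) = Set.univ := by simp
    rw [h3] at h2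
    exact h2.trans (h4 _)
  have h1 := h2.trans ((hV X).lieBracket_vectorField_eq (hV Z))
  have hd : ∀ v, HasFDerivAt (fun x ↦ rightDeriv d G x v)
      ((ContinuousLinearMap.apply ℝ _ v).comp (fderiv ℝ (rightDeriv d G) (oneCoord d G)))
      (oneCoord d G) := fun v ↦
    (ContinuousLinearMap.apply ℝ (EuclideanSpace ℝ (Fin d)) v).hasFDerivAt.comp
      (g := ContinuousLinearMap.apply ℝ (EuclideanSpace ℝ (Fin d)) v) (oneCoord d G)
      ((contDiffAt_rightDeriv d G).differentiableAt (by simp)).hasFDerivAt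
  rw [h1, VectorField.lieBracket, (hd _).fderiv, (hd _).fderiv, rightDeriv_oneCoord,
    rightDeriv_oneCoord]
  rfl

end Bracket

/-! ### The adjoint representation and left logarithmic derivatives -/

section LeftDerivative

variable (d : ℕ) {G : Type u} [TopologicalSpace G] [ChartedSpace (EuclideanSpace ℝ (Fin d)) G]
  [Group G]

/-- Conjugation by `g` in the chart at the identity. -/
noncomputable def chartConj (g : G) (x : EuclideanSpace ℝ (Fin d)) : EuclideanSpace ℝ (Fin d) :=
  oneChart d G (g * (oneChart d G).symm x * g⁻¹)

/-- The adjoint representation. -/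
noncomputable def adjoint (g : G) : EuclideanSpace ℝ (Fin d) →L[ℝ] EuclideanSpace ℝ (Fin d) :=
  fderiv ℝ (chartConj d g) (oneCoord d G)

/-- The curve `g` has left logarithmic derivative `X` at `t`. -/
def HasLeftDeriv (g : ℝ → G) (X : EuclideanSpace ℝ (Fin d)) (t : ℝ) : Prop :=
  ContinuousAt g t ∧ HasDerivAt (fun τ ↦ oneChart d G ((g t)⁻¹ * g τ)) X t

variable {d}

theorem oneCoord_conj (g : G) : chartConj d g (oneCoord d G) = oneCoord d G := by
  simp only [chartConj, oneChart_symm_oneCoord, mul_one, mul_inv_cancel]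

variable [LieGroup (𝓡 d) ∞ G]

/-- Both sides are the mixed second derivative of multiplication at the identity, so this is
symmetry of second derivatives. -/
theorem fderiv_leftDeriv (X Z : EuclideanSpace ℝ (Fin d)) :
    fderiv ℝ (leftDeriv d G) (oneCoord d G) X Z = fderiv ℝ (rightDeriv d G) (oneCoord d G) Z X := by
  have hd : HasFDerivAt (fderiv ℝ (chartMul d G))
      (fderiv ℝ (fderiv ℝ (chartMul d G)) (oneCoord d G, oneCoord d G))
      (oneCoord d G, oneCoord d G) :=
    ((contDiffAt_fderiv_chartMul d G).differentiableAt (by simp)).hasFDerivAt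
  have h1 : HasFDerivAt (fun x ↦ fderiv ℝ (chartMul d G) (oneCoord d G, x)) _ (oneCoord d G) :=
    hd.comp (oneCoord d G) (f := fun x ↦ (oneCoord d G, x))
      (hasFDerivAt_prodMk_right (oneCoord d G) (oneCoord d G))
  have h2 : HasFDerivAt (fun x ↦ fderiv ℝ (chartMul d G) (x, oneCoord d G)) _ (oneCoord d G) :=
    hd.comp (oneCoord d G) (f := fun x ↦ (x, oneCoord d G))
      (hasFDerivAt_prodMk_left (oneCoord d G) (oneCoord d G))
  have h1' := h1.clm_comp (hasFDerivAt_const (ContinuousLinearMap.inl ℝ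
    (EuclideanSpace ℝ (Fin d)) (EuclideanSpace ℝ (Fin d))) (oneCoord d G))
  have h2' := h2.clm_comp (hasFDerivAt_const (ContinuousLinearMap.inr ℝ
    (EuclideanSpace ℝ (Fin d)) (EuclideanSpace ℝ (Fin d))) (oneCoord d G))
  have h3 : fderiv ℝ (leftDeriv d G) (oneCoord d G) = _ := h1'.fderiv
  have h4 : fderiv ℝ (rightDeriv d G) (oneCoord d G) = _ := h2'.fderiv
  have hs : IsSymmSndFDerivAt ℝ (chartMul d G) (oneCoord d G, oneCoord d G) :=
    (contDiffAt_chartMul d G).isSymmSndFDerivAt (by simpa using ENat.LEInfty.out)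
  rw [h3, h4]
  simpa using hs (0, X) (Z, 0)

theorem toModel_lie' (X Z : LieAlg d G) : toModel d G ⁅X, Z⁆ =
    fderiv ℝ (rightDeriv d G) (oneCoord d G) (toModel d G X) (toModel d G Z)
      - fderiv ℝ (leftDeriv d G) (oneCoord d G) (toModel d G X) (toModel d G Z) := by
  rw [toModel_lie, fderiv_leftDeriv]

theorem eventually_conj_mem_source (g : G) :
    ∀ᶠ x in 𝓝 (oneCoord d G), g * (oneChart d G).symm x * g⁻¹ ∈ (oneChart d G).source := by
  have := topologicalGroup_of_lieGroup (𝓡 d) ∞ (G := G)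
  have h : ContinuousAt (fun x ↦ g * (oneChart d G).symm x * g⁻¹) (oneCoord d G) :=
    (continuousAt_const.mul (continuousAt_extChartAt_symm (I := 𝓡 d) (1 : G))).mul
      continuousAt_const
  refine h.eventually_mem ?_
  rw [oneChart_symm_oneCoord, mul_one, mul_inv_cancel]
  exact extChartAt_source_mem_nhds 1

theorem hasFDerivAt_chartConj (g : G) :
    HasFDerivAt (chartConj d g) (adjoint d g) (oneCoord d G) := by
  have hsymm : ContMDiffAt 𝓘(ℝ, EuclideanSpace ℝ (Fin d)) (𝓡 d) 1 (oneChart d G).symm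
      (oneCoord d G) :=
    (contMDiffOn_extChartAt_symm (1 : G)).contMDiffAt (extChartAt_target_mem_nhds 1)
  have : ContMDiffMul (𝓡 d) 1 G := ContMDiffMul.of_le (n := ∞) (by simp)
  have h1 : ContMDiffAt 𝓘(ℝ, EuclideanSpace ℝ (Fin d)) (𝓡 d) 1
      (fun x ↦ g * (oneChart d G).symm x * g⁻¹) (oneCoord d G) :=
    (contMDiffAt_const.mul hsymm).mul contMDiffAt_const
  have h2 : ContMDiffAt (𝓡 d) 𝓘(ℝ, EuclideanSpace ℝ (Fin d)) 1 (oneChart d G) 1 :=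
    contMDiffAt_extChartAt
  have h3 := ContMDiffAt.comp_of_eq (I' := 𝓡 d) h2 h1
    (by simp only [oneChart_symm_oneCoord, mul_one, mul_inv_cancel])
  exact (h3.contDiffAt.differentiableAt (by simp)).hasFDerivAt

theorem adjoint_mul (g h : G) (X : EuclideanSpace ℝ (Fin d)) :
    adjoint d (g * h) X = adjoint d g (adjoint d h X) := by
  have h1 : HasFDerivAt (chartConj d g ∘ chartConj d h) ((adjoint d g).comp (adjoint d h))
      (oneCoord d G) := by
    refine HasFDerivAt.comp _ ?_ (hasFDerivAt_chartConj h)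
    rw [oneCoord_conj]
    exact hasFDerivAt_chartConj g
  have h2 : chartConj d (g * h) =ᶠ[𝓝 (oneCoord d G)] chartConj d g ∘ chartConj d h := by
    filter_upwards [eventually_conj_mem_source h] with x hx
    simp only [chartConj, Function.comp]
    rw [(oneChart d G).left_inv hx]
    congr 1
    group
  rw [(hasFDerivAt_chartConj (g * h)).unique (h1.congr_of_eventuallyEq h2)]
  rfl

theorem adjoint_one (X : EuclideanSpace ℝ (Fin d)) : adjoint d (1 : G) X = X := by
  have h : chartConj d (1 : G) =ᶠ[𝓝 (oneCoord d G)] id := by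
    filter_upwards [extChartAt_target_mem_nhds (I := 𝓡 d) (1 : G)] with y hy
    rw [chartConj, one_mul, inv_one, mul_one]
    exact (oneChart d G).right_inv hy
  rw [(hasFDerivAt_chartConj (1 : G)).unique ((hasFDerivAt_id _).congr_of_eventuallyEq h)]
  rfl

theorem hasFDerivAt_chartMul_oneCoord :
    HasFDerivAt (chartMul d G) (ContinuousLinearMap.fst ℝ _ _ + ContinuousLinearMap.snd ℝ _ _)
      (oneCoord d G, oneCoord d G) := by
  have h := ((contDiffAt_chartMul d G).differentiableAt (by simp)).hasFDerivAt
  refine h.congr_fderiv (ContinuousLinearMap.ext fun p ↦ ?_)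
  have h1 : p = ContinuousLinearMap.inl ℝ _ _ p.1 + ContinuousLinearMap.inr ℝ _ _ p.2 := by simp
  conv_lhs => rw [h1, map_add]
  exact congrArg₂ (· + ·) (leftDeriv_oneCoord d G p.1) (rightDeriv_oneCoord d G p.2)

/-- Differentiate `g * y = (g * y * g⁻¹) * g` in `y` at the identity. -/
theorem eventually_leftDeriv_adjoint :
    ∀ᶠ g in 𝓝 (1 : G), ∀ Z, leftDeriv d G (oneChart d G g) (adjoint d g Z)
      = rightDeriv d G (oneChart d G g) Z := by
  have := topologicalGroup_of_lieGroup (𝓡 d) ∞ (G := G)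
  have hc : ContinuousAt (oneChart d G) 1 := continuousAt_extChartAt 1
  have h1 := (hc.prodMk continuousAt_const).eventually (eventually_contDiffAt_chartMul d G)
  have h2 := (continuousAt_const.prodMk hc).eventually (eventually_contDiffAt_chartMul d G)
  filter_upwards [h1, h2, extChartAt_source_mem_nhds (I := 𝓡 d) (1 : G)] with g hg1 hg2 hg Z
  have h3 : HasFDerivAt (fun y ↦ chartMul d G (oneChart d G g, y)) (rightDeriv d G (oneChart d G g))
      (oneCoord d G) :=
    (hg1.differentiableAt (by simp)).hasFDerivAt.comp (oneCoord d G)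
      (hasFDerivAt_prodMk_right _ (oneCoord d G))
  have h4 : HasFDerivAt (fun y ↦ chartMul d G (y, oneChart d G g)) (leftDeriv d G (oneChart d G g))
      (oneCoord d G) :=
    (hg2.differentiableAt (by simp)).hasFDerivAt.comp (oneCoord d G)
      (f := fun e ↦ (e, oneChart d G g)) (hasFDerivAt_prodMk_left (oneCoord d G) _)
  have h5 : HasFDerivAt ((fun y ↦ chartMul d G (y, oneChart d G g)) ∘ chartConj d g)
      ((leftDeriv d G (oneChart d G g)).comp (adjoint d g)) (oneCoord d G) := by
    refine HasFDerivAt.comp _ ?_ (hasFDerivAt_chartConj g)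
    rw [oneCoord_conj]
    exact h4
  have h6 : (fun y ↦ chartMul d G (oneChart d G g, y)) =ᶠ[𝓝 (oneCoord d G)]
      (fun y ↦ chartMul d G (y, oneChart d G g)) ∘ chartConj d g := by
    filter_upwards [eventually_conj_mem_source g] with y hy
    simp only [chartMul, chartConj, Function.comp]
    rw [(oneChart d G).left_inv hy, (oneChart d G).left_inv hg]
    congr 1
    group
  rw [h3.unique (h5.congr_of_eventuallyEq h6)]
  rfl

namespace HasLeftDeriv

variable {g h : ℝ → G} {X Y : EuclideanSpace ℝ (Fin d)} {t : ℝ}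

theorem const_mul (a : G) (hg : HasLeftDeriv d g X t) : HasLeftDeriv d (fun τ ↦ a * g τ) X t := by
  have := topologicalGroup_of_lieGroup (𝓡 d) ∞ (G := G)
  refine ⟨continuousAt_const.mul hg.1, ?_⟩
  simpa [mul_assoc] using hg.2

theorem tendsto (hg : HasLeftDeriv d g X t) :
    Tendsto (fun τ ↦ (g t)⁻¹ * g τ) (𝓝 t) (𝓝 1) := by
  have := topologicalGroup_of_lieGroup (𝓡 d) ∞ (G := G)
  simpa using (tendsto_const_nhds (x := (g t)⁻¹)).mul hg.1.tendsto

theorem conj (a : G) (hg : HasLeftDeriv d g X t) :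
    HasLeftDeriv d (fun τ ↦ a * g τ * a⁻¹) (adjoint d a X) t := by
  have := topologicalGroup_of_lieGroup (𝓡 d) ∞ (G := G)
  refine ⟨(continuousAt_const.mul hg.1).mul continuousAt_const, ?_⟩
  have h1 : HasDerivAt (chartConj d a ∘ fun τ ↦ oneChart d G ((g t)⁻¹ * g τ))
      (adjoint d a X) t := by
    refine HasFDerivAt.comp_hasDerivAt _ ?_ hg.2
    rw [inv_mul_cancel]
    exact hasFDerivAt_chartConj a
  refine h1.congr_of_eventuallyEq ?_
  filter_upwards [hg.tendsto (extChartAt_source_mem_nhds (I := 𝓡 d) 1)] with τ hτ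
  simp only [chartConj, Function.comp]
  rw [(oneChart d G).left_inv hτ]
  congr 1
  group

/-- Near `t`, `(g t * h t)⁻¹ * (g τ * h τ)` is the product of `(h t)⁻¹ * ((g t)⁻¹ * g τ) * h t` and
`(h t)⁻¹ * h τ`, and multiplication has derivative addition at the identity. -/
theorem mul (hg : HasLeftDeriv d g X t) (hh : HasLeftDeriv d h Y t) :
    HasLeftDeriv d (fun τ ↦ g τ * h τ) (adjoint d (h t)⁻¹ X + Y) t := by
  have := topologicalGroup_of_lieGroup (𝓡 d) ∞ (G := G)
  refine ⟨hg.1.mul hh.1, ?_⟩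
  have h1 := hg.conj (h t)⁻¹
  have h2 : HasDerivAt (chartMul d G ∘ fun τ ↦
      (oneChart d G (((h t)⁻¹ * g t * (h t)⁻¹⁻¹)⁻¹ * ((h t)⁻¹ * g τ * (h t)⁻¹⁻¹)),
        oneChart d G ((h t)⁻¹ * h τ))) (adjoint d (h t)⁻¹ X + Y) t := by
    refine HasFDerivAt.comp_hasDerivAt (l' := ContinuousLinearMap.fst ℝ _ _ +
      ContinuousLinearMap.snd ℝ _ _) _ ?_ (h1.2.prodMk hh.2)
    simp only [inv_mul_cancel]
    exact hasFDerivAt_chartMul_oneCoord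
  refine h2.congr_of_eventuallyEq ?_
  filter_upwards [h1.tendsto (extChartAt_source_mem_nhds (I := 𝓡 d) 1),
    hh.tendsto (extChartAt_source_mem_nhds (I := 𝓡 d) 1)] with τ hτ hτ'
  simp only [chartMul, Function.comp]
  rw [(oneChart d G).left_inv hτ, (oneChart d G).left_inv hτ']
  congr 1
  group

end HasLeftDeriv

/-- Curves with the same constant left logarithmic derivative agree. -/
theorem eq_of_hasLeftDeriv {g h : ℝ → G} {X : EuclideanSpace ℝ (Fin d)}
    (hg : ∀ t, HasLeftDeriv d g X t) (hh : ∀ t, HasLeftDeriv d h X t) (h0 : g 0 = h 0) : g = h := by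
  have := t2Space_of_lieGroup d G
  have key : ∀ {g : ℝ → G}, (∀ t, HasLeftDeriv d g X t) →
      IsMIntegralCurve g (mulInvariantVectorField (I := 𝓡 d) ((toModel d G).symm X)) :=
    fun hg t ↦ hasMFDerivAt_of_hasDerivAt_oneChart (hg t).1 (hg t).2
  exact isMIntegralCurve_Ioo_eq_of_contMDiff_boundaryless (t₀ := 0)
    (contMDiff_leftInvariant _) (key hg) (key hh) h0

theorem hasLeftDeriv_lieExp (X : LieAlg d G) (t : ℝ) :
    HasLeftDeriv d (fun τ : ℝ ↦ (lieExp (τ • X) : G)) (toModel d G X) t := by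
  obtain ⟨γ, ⟨h0, hγ⟩, -⟩ := existsUnique_integralCurve X
  have h : (fun τ : ℝ ↦ (lieExp (τ • X) : G)) = γ := by
    funext τ
    have h1 := hγ.comp_mul τ
    rw [← mulInvariantVectorField_smul] at h1
    rw [lieExp_eq (by simpa using h0) h1]
    simp
  rw [h]
  exact ⟨(hγ t).continuousAt, hasDerivAt_oneChart_of_hasMFDerivAt (hγ t)⟩

theorem lieExp_zero : (lieExp (0 : LieAlg d G) : G) = 1 := by
  obtain ⟨γ, ⟨h0, hγ⟩, -⟩ := existsUnique_integralCurve (0 : LieAlg d G)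
  have h1 := hγ.comp_mul 0
  rw [← mulInvariantVectorField_smul, zero_smul] at h1
  rw [lieExp_eq (by simpa using h0) h1]
  simpa using h0

theorem lieExp_add_smul (X : LieAlg d G) (a b : ℝ) :
    (lieExp ((a + b) • X) : G) = lieExp (a • X) * lieExp (b • X) := by
  have h1 : ∀ t, HasLeftDeriv d (fun τ : ℝ ↦ (lieExp ((a + τ) • X) : G)) (toModel d G X) t := by
    intro t
    have h := hasLeftDeriv_lieExp X (a + t)
    have hc : HasDerivAt (fun τ : ℝ ↦ a + τ) 1 t := by simpa using (hasDerivAt_id t).const_add a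
    refine ⟨ContinuousAt.comp (f := fun τ : ℝ ↦ a + τ) h.1 hc.continuousAt, ?_⟩
    exact (HasDerivAt.scomp t h.2 hc).congr_deriv (one_smul _ _)
  exact congrFun (eq_of_hasLeftDeriv h1
    (fun t ↦ (hasLeftDeriv_lieExp X t).const_mul (lieExp (a • X))) (by simp [lieExp_zero])) b

theorem lieExp_neg (X : LieAlg d G) : (lieExp (-X) : G) = (lieExp X)⁻¹ := by
  have h := lieExp_add_smul X (-1) 1
  rw [neg_add_cancel, zero_smul, lieExp_zero, neg_one_smul, one_smul] at h
  exact eq_inv_of_mul_eq_one_left h.symm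

theorem lieExp_adjoint (g : G) (X : LieAlg d G) :
    lieExp ((toModel d G).symm (adjoint d g (toModel d G X))) = g * lieExp X * g⁻¹ := by
  have h1 := fun t ↦ (hasLeftDeriv_lieExp X t).conj g
  have h2 := hasLeftDeriv_lieExp ((toModel d G).symm (adjoint d g (toModel d G X)))
  rw [LinearEquiv.apply_symm_apply] at h2
  simpa using congrFun (eq_of_hasLeftDeriv h2 h1 (by simp [lieExp_zero])) 1

end LeftDerivative

open Finset

/-! ### `Ad (exp X) = exp (ad X)` -/

section AdjointExp

variable {d : ℕ} {G : Type u} [TopologicalSpace G] [ChartedSpace (EuclideanSpace ℝ (Fin d)) G]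
  [Group G] [LieGroup (𝓡 d) ∞ G]

theorem hasDerivAt_oneChart_lieExp (X : LieAlg d G) :
    HasDerivAt (fun t : ℝ ↦ oneChart d G (lieExp (t • X))) (toModel d G X) 0 := by
  simpa [lieExp_zero] using (hasLeftDeriv_lieExp X 0).2

theorem hasDerivAt_adjoint_lieExp_zero (X Z : LieAlg d G) :
    HasDerivAt (fun t : ℝ ↦ adjoint d (lieExp (t • X) : G) (toModel d G Z)) (toModel d G ⁅X, Z⁆)
      0 := by
  have hx := hasDerivAt_oneChart_lieExp X
  have h0 : oneChart d G (lieExp ((0 : ℝ) • X)) = oneCoord d G := by rw [zero_smul, lieExp_zero]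
  have hA : HasDerivAt (leftDeriv d G ∘ fun t : ℝ ↦ oneChart d G (lieExp (t • X)))
      (fderiv ℝ (leftDeriv d G) (oneCoord d G) (toModel d G X)) 0 := by
    refine HasFDerivAt.comp_hasDerivAt _ ?_ hx
    rw [h0]
    exact ((contDiffAt_leftDeriv d G).differentiableAt (by simp)).hasFDerivAt
  have hB : HasDerivAt (rightDeriv d G ∘ fun t : ℝ ↦ oneChart d G (lieExp (t • X)))
      (fderiv ℝ (rightDeriv d G) (oneCoord d G) (toModel d G X)) 0 := by
    refine HasFDerivAt.comp_hasDerivAt _ ?_ hx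
    rw [h0]
    exact ((contDiffAt_rightDeriv d G).differentiableAt (by simp)).hasFDerivAt
  have hA0 : (leftDeriv d G ∘ fun t : ℝ ↦ oneChart d G (lieExp (t • X))) 0 = 1 := by
    rw [Function.comp_apply, h0]
    exact ContinuousLinearMap.ext (leftDeriv_oneCoord d G)
  have hB0 : (rightDeriv d G ∘ fun t : ℝ ↦ oneChart d G (lieExp (t • X))) 0 = 1 := by
    rw [Function.comp_apply, h0]
    exact ContinuousLinearMap.ext (rightDeriv_oneCoord d G)
  -- Near the identity `Ad g` is the inverse of `leftDeriv` composed with `rightDeriv`. Both are the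
  -- identity at the base point, so the derivative is the difference of theirs, which is the
  -- bracket.
  have hI : HasDerivAt (Ring.inverse ∘ leftDeriv d G ∘ fun t : ℝ ↦ oneChart d G (lieExp (t • X)))
      (-fderiv ℝ (leftDeriv d G) (oneCoord d G) (toModel d G X)) 0 := by
    have h1 := hasFDerivAt_ringInverse (𝕜 := ℝ)
      (1 : (EuclideanSpace ℝ (Fin d) →L[ℝ] EuclideanSpace ℝ (Fin d))ˣ)
    refine (HasFDerivAt.comp_hasDerivAt (0 : ℝ) (by rw [hA0]; exact h1) hA).congr_deriv ?_
    simp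
  have h1 := hI.clm_apply (hB.clm_apply (hasDerivAt_const (0 : ℝ) (toModel d G Z)))
  have hc : Tendsto (fun t : ℝ ↦ (lieExp (t • X) : G)) (𝓝 0) (𝓝 1) := by
    simpa [lieExp_zero] using (hasLeftDeriv_lieExp X 0).1.tendsto
  have hu := hA.continuousAt.tendsto
  rw [hA0] at hu
  refine (h1.congr_deriv ?_).congr_of_eventuallyEq ?_
  · simp only [Function.comp_apply] at hA0 hB0 ⊢
    rw [hA0, hB0, toModel_lie']
    simp only [Ring.inverse_one, one_apply_eq_self, map_zero, add_zero]
    simp only [neg_apply]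
    abel
  · filter_upwards [hu.eventually (Units.isOpen.mem_nhds isUnit_one),
      hc.eventually (eventually_leftDeriv_adjoint (d := d))] with t ht1 ht2
    have h2 := ht2 (toModel d G Z)
    have h3 := Ring.inverse_mul_cancel _ ht1
    calc adjoint d (lieExp (t • X) : G) (toModel d G Z)
      _ = (1 : EuclideanSpace ℝ (Fin d) →L[ℝ] EuclideanSpace ℝ (Fin d))
          (adjoint d (lieExp (t • X) : G) (toModel d G Z)) := rfl
      _ = _ := by
        rw [← h3]
        exact congrArg (⇑(Ring.inverse (leftDeriv d G (oneChart d G (lieExp (t • X)))))) h2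

theorem hasDerivAt_adjoint_lieExp (X Z : LieAlg d G) (t : ℝ) :
    HasDerivAt (fun τ : ℝ ↦ adjoint d (lieExp (τ • X) : G) (toModel d G Z))
      (adjoint d (lieExp (t • X) : G) (toModel d G ⁅X, Z⁆)) t := by
  have h : HasDerivAt (fun τ : ℝ ↦ adjoint d (lieExp ((τ - t) • X) : G) (toModel d G Z))
      (toModel d G ⁅X, Z⁆) t := by
    refine HasDerivAt.comp_sub_const
      (f := fun τ : ℝ ↦ adjoint d (lieExp (τ • X) : G) (toModel d G Z)) t t ?_
    rw [sub_self]
    exact hasDerivAt_adjoint_lieExp_zero X Z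
  have h2 := (adjoint d (lieExp (t • X) : G)).hasFDerivAt.comp_hasDerivAt t h
  refine h2.congr_of_eventuallyEq (Eventually.of_forall fun τ ↦ ?_)
  simp only [Function.comp_apply]
  rw [← adjoint_mul, ← lieExp_add_smul, add_sub_cancel]

/-- Induction on `k`: the derivative of `Ad (exp tX) Z` is `Ad (exp tX) ⁅X, Z⁆`, known by induction
because `⁅X, Z⁆` is killed by one power of `ad X` fewer. Both sides have that derivative and agree
at `0`. -/
theorem adjoint_lieExp_smul (X : LieAlg d G) (k : ℕ) (Z : LieAlg d G)
    (hZ : (LieAlgebra.ad ℝ (LieAlg d G) X ^ k) Z = 0) (t : ℝ) :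
    adjoint d (lieExp (t • X) : G) (toModel d G Z) = toModel d G
      (∑ j ∈ range k, t ^ j • (j.factorial : ℝ)⁻¹ • (LieAlgebra.ad ℝ (LieAlg d G) X ^ j) Z) := by
  induction k generalizing Z t with
  | zero => simp_all
  | succ k ih =>
    have hZ' : (LieAlgebra.ad ℝ (LieAlg d G) X ^ k) ⁅X, Z⁆ = 0 := by
      rwa [pow_succ] at hZ
    have h1 : ∀ t : ℝ, HasDerivAt (fun t : ℝ ↦ toModel d G (∑ j ∈ range (k + 1),
        t ^ j • (j.factorial : ℝ)⁻¹ • (LieAlgebra.ad ℝ (LieAlg d G) X ^ j) Z))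
        (adjoint d (lieExp (t • X) : G) (toModel d G ⁅X, Z⁆)) t := by
      intro t
      rw [ih _ hZ']
      simp only [map_sum, map_smul]
      have h2 := HasDerivAt.fun_sum (u := range (k + 1)) (x := t) (fun j _ ↦
        (hasDerivAt_pow j t).smul_const ((j.factorial : ℝ)⁻¹ •
          toModel d G ((LieAlgebra.ad ℝ (LieAlg d G) X ^ j) Z)))
      refine h2.congr_deriv ?_
      rw [sum_range_succ']
      simp only [Nat.cast_zero, zero_mul, zero_smul, add_zero]
      refine sum_congr rfl fun j _ ↦ ?_
      rw [pow_succ _ j, Nat.factorial_succ, Nat.add_sub_cancel, smul_smul, smul_smul]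
      congr 1
      push_cast
      have := Nat.factorial_ne_zero j
      field_simp
    have h3 := fun t ↦ (hasDerivAt_adjoint_lieExp (G := G) X Z t).sub (h1 t)
    have h4 := is_const_of_deriv_eq_zero (fun t ↦ (h3 t).differentiableAt)
      (fun t ↦ by rw [(h3 t).deriv, sub_self]) t 0
    rw [← sub_eq_zero]
    refine h4.trans ?_
    simp [sum_range_succ', lieExp_zero, adjoint_one]

theorem adjoint_lieExp {s : ℕ}
    (hs : LieModule.lowerCentralSeries ℝ (LieAlg d G) (LieAlg d G) s = ⊥) (X Z : LieAlg d G) :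
    adjoint d (lieExp X : G) (toModel d G Z) = toModel d G (expAd s X Z) := by
  have h := adjoint_lieExp_smul (G := G) X (s + 1) Z (ad_pow_eq_zero hs X Z (by lia)) 1
  simpa [expAd] using h

theorem lieExp_conj {s : ℕ}
    (hs : LieModule.lowerCentralSeries ℝ (LieAlg d G) (LieAlg d G) s = ⊥) (X Y : LieAlg d G) :
    (lieExp X * lieExp Y * (lieExp X)⁻¹ : G) = lieExp (expAd s X Y) := by
  rw [← lieExp_adjoint, adjoint_lieExp hs, LinearEquiv.symm_apply_apply]

end AdjointExp

/-! ### First-order development of a curve with small left derivative -/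

section Development

variable (d : ℕ) (G : Type u) [TopologicalSpace G] [ChartedSpace (EuclideanSpace ℝ (Fin d)) G]
  [Group G] [LieGroup (𝓡 d) ∞ G]

theorem eventually_hasDerivAt_oneChart :
    ∀ᶠ x in 𝓝 (oneCoord d G), ∀ (v : ℝ → G) (X : EuclideanSpace ℝ (Fin d)) (t : ℝ),
      HasLeftDeriv d v X t → v t = (oneChart d G).symm x →
      HasDerivAt (fun τ ↦ oneChart d G (v τ)) (rightDeriv d G x X) t := by
  have hc : Tendsto (fun x ↦ (x, oneCoord d G)) (𝓝 (oneCoord d G))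
      (𝓝 (oneCoord d G, oneCoord d G)) :=
    Continuous.tendsto' (by fun_prop) _ _ rfl
  filter_upwards [hc.eventually (eventually_contDiffAt_chartMul d G)] with x hx v X t hv hvx
  have h1 : HasFDerivAt (fun y ↦ chartMul d G (x, y)) (rightDeriv d G x) (oneCoord d G) :=
    (hx.differentiableAt (by simp)).hasFDerivAt.comp (oneCoord d G)
      (hasFDerivAt_prodMk_right x (oneCoord d G))
  have h2 : HasDerivAt ((fun y ↦ chartMul d G (x, y)) ∘ fun τ ↦ oneChart d G ((v t)⁻¹ * v τ))
      (rightDeriv d G x X) t := by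
    refine HasFDerivAt.comp_hasDerivAt _ ?_ hv.2
    rw [inv_mul_cancel]
    exact h1
  refine h2.congr_of_eventuallyEq ?_
  filter_upwards [hv.tendsto.eventually_mem (extChartAt_source_mem_nhds (I := 𝓡 d) (1 : G))]
    with τ hτ
  simp only [Function.comp_apply, chartMul]
  rw [(oneChart d G).left_inv hτ, ← hvx, mul_inv_cancel_left]

/-- A curve through the identity with small left logarithmic derivative is, to first order, the
integral of that derivative. -/
theorem exists_norm_oneChart_sub_le :
    ∃ r > 0, ∃ K > 0, ∀ δ > 0, 2 * δ ≤ r →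
      ∀ (v : ℝ → G) (q Q : ℝ → EuclideanSpace ℝ (Fin d)), v 0 = 1 →
      (∀ t, HasLeftDeriv d v (q t) t) → (∀ t, HasDerivAt Q (q t) t) →
      (∀ t ∈ Set.Icc (0 : ℝ) 1, ‖q t‖ ≤ δ) →
      v 1 ∈ (oneChart d G).source ∧ ‖oneChart d G (v 1) - oneCoord d G‖ ≤ 2 * δ ∧
        ‖oneChart d G (v 1) - oneCoord d G - (Q 1 - Q 0)‖ ≤ K * δ ^ 2 := by
  have := t2Space_of_lieGroup d G
  obtain ⟨K, hK, hKρ⟩ := ((contDiffAt_rightDeriv d G).differentiableAt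
    (by simp)).hasFDerivAt.isBigO_sub.exists_pos
  have htarget : ∀ᶠ x in 𝓝 (oneCoord d G), x ∈ (oneChart d G).target :=
    extChartAt_target_mem_nhds (I := 𝓡 d) (1 : G)
  obtain ⟨ε, hε, hball⟩ := Metric.nhds_basis_closedBall.eventually_iff.1
    ((htarget.and (eventually_hasDerivAt_oneChart d G)).and hKρ.bound)
  have hρ1 : rightDeriv d G (oneCoord d G) = ContinuousLinearMap.id ℝ _ :=
    ContinuousLinearMap.ext (rightDeriv_oneCoord d G)
  -- This radius gives `K * (2 * δ) ≤ 1 / 2`, so the coordinate velocity is at most `3 / 2 * δ`,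
  -- strictly below `2 * δ`.
  refine ⟨min ε (1 / (2 * K)), by positivity, K * 2, by positivity,
    fun δ hδ hδr v q Q hv0 hv hQ hq ↦ ?_⟩
  have hδε : 2 * δ ≤ ε := hδr.trans (min_le_left _ _)
  have hδK : K * (2 * δ) ≤ 1 / 2 := by
    have := mul_le_mul_of_nonneg_left (hδr.trans (min_le_right _ _)) hK.le
    rwa [show K * (1 / (2 * K)) = 1 / 2 by field_simp] at this
  have hvc : Continuous v := continuous_iff_continuousAt.2 fun t ↦ (hv t).1
  have hρ : ∀ x, ‖x - oneCoord d G‖ ≤ 2 * δ →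
      ∀ Z, ‖rightDeriv d G x Z - Z‖ ≤ K * (2 * δ) * ‖Z‖ := by
    intro x hx Z
    have h1 := (hball (mem_closedBall_iff_norm.2 (hx.trans hδε))).2
    rw [hρ1] at h1
    calc ‖rightDeriv d G x Z - Z‖
      _ = ‖(rightDeriv d G x - ContinuousLinearMap.id ℝ (EuclideanSpace ℝ (Fin d))) Z‖ := rfl
      _ ≤ ‖rightDeriv d G x - ContinuousLinearMap.id ℝ (EuclideanSpace ℝ (Fin d))‖ * ‖Z‖ :=
        ContinuousLinearMap.le_opNorm _ _
      _ ≤ _ := by gcongr; exact h1.trans (by gcongr)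
  -- Continuous induction on `[0, 1]`: the times at which the curve is in the chart and inside the
  -- cone of slope `2 * δ` form a closed set containing `0` that extends to the right.
  set S : Set ℝ := {t | v t ∈ (oneChart d G).source ∧
    ‖oneChart d G (v t) - oneCoord d G‖ ≤ 2 * δ * t} with hS
  have hderiv : ∀ t ∈ S, t ≤ 1 → HasDerivAt (fun τ ↦ oneChart d G (v τ))
      (rightDeriv d G (oneChart d G (v t)) (q t)) t := by
    intro t ht ht1
    refine (hball (mem_closedBall_iff_norm.2 (ht.2.trans ?_))).1.2 v (q t) t (hv t)
      ((oneChart d G).left_inv ht.1).symm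
    nlinarith
  have hclosed : IsClosed (S ∩ Set.Icc 0 1) := by
    -- The chart domain is only open; membership in it survives limits because the cone confines the
    -- curve to the compact image of a closed ball.
    set B := (oneChart d G).symm '' Metric.closedBall (oneCoord d G) ε with hB
    have hBc : IsClosed B := by
      refine IsCompact.isClosed ((isCompact_closedBall _ _).image_of_continuousOn ?_)
      exact (continuousOn_extChartAt_symm (I := 𝓡 d) (1 : G)).mono fun x hx ↦ (hball hx).1.1
    have hBs : B ⊆ (oneChart d G).source := by
      rintro _ ⟨x, hx, rfl⟩
      exact (oneChart d G).map_target (hball hx).1.1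
    have h1 : IsClosed (v ⁻¹' B ∩ Set.Icc 0 1) := (hBc.preimage hvc).inter isClosed_Icc
    have h2 : ContinuousOn (fun t ↦ ‖oneChart d G (v t) - oneCoord d G‖ - 2 * δ * t)
        (v ⁻¹' B ∩ Set.Icc 0 1) := by
      refine ContinuousOn.sub (ContinuousOn.norm (ContinuousOn.sub ?_ continuousOn_const))
        (by fun_prop)
      exact (continuousOn_extChartAt (I := 𝓡 d) (1 : G)).comp hvc.continuousOn
        fun t ht ↦ hBs ht.1
    convert h2.preimage_isClosed_of_isClosed h1 (isClosed_Iic (a := (0 : ℝ))) using 1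
    ext t
    simp only [Set.mem_inter_iff, Set.mem_preimage, Set.mem_Iic, sub_nonpos, hS, Set.mem_ofPred_eq]
    constructor
    · rintro ⟨⟨h1, h2⟩, h3⟩
      refine ⟨⟨⟨oneChart d G (v t), mem_closedBall_iff_norm.2 (h2.trans ?_),
        (oneChart d G).left_inv h1⟩, h3⟩, h2⟩
      nlinarith [h3.2]
    · rintro ⟨⟨h1, h2⟩, h3⟩
      exact ⟨⟨hBs h1, h3⟩, h2⟩
  have hsub : Set.Icc 0 1 ⊆ S := by
    refine hclosed.Icc_subset_of_forall_mem_nhdsWithin ?_ ?_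
    · refine ⟨?_, ?_⟩
      · rw [hv0]
        exact mem_extChartAt_source (1 : G)
      · rw [hv0, sub_self, norm_zero, mul_zero]
    · rintro t ⟨ht, ht0, ht1⟩
      have hd := hderiv t ht ht1.le
      have hn : ‖rightDeriv d G (oneChart d G (v t)) (q t)‖ < 2 * δ := by
        have h1 := hρ (oneChart d G (v t)) (ht.2.trans (by nlinarith)) (q t)
        have h2 := hq t ⟨ht0, ht1.le⟩
        have h3 := norm_le_norm_add_norm_sub' (rightDeriv d G (oneChart d G (v t)) (q t)) (q t)
        nlinarith [norm_nonneg (q t)]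
      have h1 := hd.hasDerivWithinAt (s := Set.Ioi t) |>.limsup_norm_slope_le hn
      filter_upwards [h1, self_mem_nhdsWithin, (hvc.tendsto t).mono_left nhdsWithin_le_nhds
        |>.eventually_mem (IsOpen.mem_nhds (isOpen_extChartAt_source (I := 𝓡 d) (1 : G)) ht.1)]
        with τ hτ1 hτ2 hτ3
      refine ⟨hτ3, ?_⟩
      have hτ2' : 0 < τ - t := sub_pos.2 hτ2
      rw [Real.norm_of_nonneg hτ2'.le, inv_mul_lt_iff₀ hτ2'] at hτ1
      have h4 := norm_sub_le_norm_sub_add_norm_sub (oneChart d G (v τ)) (oneChart d G (v t))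
        (oneCoord d G)
      linarith [ht.2]
  have h01 : (1 : ℝ) ∈ S := hsub (by simp)
  refine ⟨h01.1, by simpa using h01.2, ?_⟩
  have h1 := norm_image_sub_le_of_norm_deriv_le_segment_01'
    (f := fun t ↦ oneChart d G (v t) - Q t) (C := K * 2 * δ ^ 2)
    (fun t ht ↦ ((hderiv t (hsub ht) ht.2).sub (hQ t)).hasDerivWithinAt) (fun t ht ↦ by
      have ht' := Set.Ico_subset_Icc_self ht
      refine (hρ _ ((hsub ht').2.trans (by nlinarith [ht.2])) (q t)).trans ?_
      have := hq t ht'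
      have : 0 < K * (2 * δ) := by positivity
      nlinarith)
  rw [hv0] at h1
  refine le_trans (le_of_eq (congrArg norm ?_)) h1
  abel

end Development

/-! ### A strict derivative from approximate differences -/

section LocalMultiplication

variable {E : Type*} [NormedAddCommGroup E] [NormedSpace ℝ E]

/-- Here `W (y, z)` stands for `exp (-z) * exp y` in the chart. The cocycle identity `hmul` and the
derivative of `m` at `(a, a)` make `W (y, x) - W (z, x)` equal to `W (y, z) - a` up to `o(‖y - z‖)`.
This is `D y (y - z)` to first order, and `D` is continuous. -/
theorem hasStrictFDerivAt_of_local_mul {m : E × E → E} {a x : E} {W : E × E → E} {D : E → E →L[ℝ] E}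
    {K : ℝ} (hm : HasStrictFDerivAt m
      (ContinuousLinearMap.fst ℝ E E + ContinuousLinearMap.snd ℝ E E)
      (a, a)) (hD : Continuous D)
    (hW : ∀ᶠ p in 𝓝 (x, x), ‖W p - a‖ ≤ K * ‖p.1 - p.2‖ ∧
      ‖W p - a - D p.1 (p.1 - p.2)‖ ≤ K * ‖p.1 - p.2‖ ^ 2)
    (hmul : ∀ᶠ p in 𝓝 (x, x), m (W (p.2, x), W p) = W (p.1, x))
    (hone : ∀ᶠ p in 𝓝 (x, x), m (W p, a) = W p) :
    HasStrictFDerivAt (fun y ↦ W (y, x)) (D x) x := by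
  have hWO : (fun p ↦ W p - a) =O[𝓝 (x, x)] fun p ↦ p.1 - p.2 :=
    Asymptotics.IsBigO.of_bound K (hW.mono fun p hp ↦ hp.1)
  have hdiff : Tendsto (fun p : E × E ↦ p.1 - p.2) (𝓝 (x, x)) (𝓝 0) :=
    Continuous.tendsto' (by fun_prop) _ _ (by simp)
  have hWt : Tendsto W (𝓝 (x, x)) (𝓝 a) :=
    tendsto_sub_nhds_zero_iff.1 (hWO.trans_tendsto hdiff)
  have hx2 : Tendsto (fun p : E × E ↦ (p.2, x)) (𝓝 (x, x)) (𝓝 (x, x)) :=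
    Continuous.tendsto' (by fun_prop) _ _ rfl
  have hk : Tendsto (fun p : E × E ↦ ((W (p.2, x), W p), (W (p.2, x), a))) (𝓝 (x, x))
      (𝓝 ((a, a), (a, a))) :=
    ((hWt.comp hx2).prodMk_nhds hWt).prodMk_nhds ((hWt.comp hx2).prodMk_nhds tendsto_const_nhds)
  have h1 := hm.isLittleO.comp_tendsto hk
  have h2 : (fun p ↦ m (W (p.2, x), W p) - m (W (p.2, x), a) - (W p - a))
      =o[𝓝 (x, x)] fun p ↦ p.1 - p.2 := by
    refine (h1.trans_isBigO ?_).congr_left fun p ↦ by simp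
    refine Asymptotics.IsBigO.trans (Asymptotics.IsBigO.of_bound 1 ?_) hWO
    refine Eventually.of_forall fun p ↦ ?_
    simp [Prod.norm_def]
  have h3 : (fun p ↦ W p - a - D p.1 (p.1 - p.2)) =o[𝓝 (x, x)] fun p ↦ p.1 - p.2 := by
    have h4 : (fun p ↦ W p - a - D p.1 (p.1 - p.2)) =O[𝓝 (x, x)] fun p ↦ ‖p.1 - p.2‖ ^ 2 :=
      Asymptotics.IsBigO.of_bound K (hW.mono fun p hp ↦ by simpa using hp.2)
    refine h4.trans_isLittleO ?_
    exact (Asymptotics.isLittleO_norm_pow_id one_lt_two).comp_tendsto hdiff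
  have h4 : (fun p ↦ (D p.1 - D x) (p.1 - p.2)) =o[𝓝 (x, x)] fun p ↦ p.1 - p.2 := by
    have h5 : (fun p : E × E ↦ D p.1 - D x) =o[𝓝 (x, x)] fun _ ↦ (1 : ℝ) := by
      rw [Asymptotics.isLittleO_one_iff]
      exact Continuous.tendsto' ((hD.comp continuous_fst).sub continuous_const) _ _ (by simp)
    refine Asymptotics.IsBigO.trans_isLittleO (g := fun p ↦ ‖D p.1 - D x‖ * ‖p.1 - p.2‖) ?_ ?_
    · refine Asymptotics.IsBigO.of_bound 1 (Eventually.of_forall fun p ↦ ?_)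
      rw [one_mul, norm_mul, norm_norm, norm_norm]
      exact ContinuousLinearMap.le_opNorm _ _
    · have h6 := h5.norm_left.mul_isBigO (f₂ := fun p : E × E ↦ ‖p.1 - p.2‖)
        (g₂ := fun p : E × E ↦ ‖p.1 - p.2‖) (Asymptotics.isBigO_refl _ _)
      simpa using h6
  refine .of_isLittleO (((h2.add h3).add h4).congr' ?_ EventuallyEq.rfl)
  filter_upwards [hmul, hx2.eventually hone] with p hp hp'
  rw [hp, hp', sub_apply]
  abel

end LocalMultiplication

/-! ### The derivative of the exponential map and the BCH formula -/

section ExpDerivative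

variable {d : ℕ} {G : Type u} [TopologicalSpace G] [ChartedSpace (EuclideanSpace ℝ (Fin d)) G]
  [Group G] [LieGroup (𝓡 d) ∞ G]

variable (d G) in
/-- The bracket, transported to the model space. -/
noncomputable def adModel : EuclideanSpace ℝ (Fin d) →L[ℝ]
    EuclideanSpace ℝ (Fin d) →L[ℝ] EuclideanSpace ℝ (Fin d) :=
  fderiv ℝ (rightDeriv d G) (oneCoord d G) - (fderiv ℝ (rightDeriv d G) (oneCoord d G)).flip

variable (d G) in
/-- The derivative of the exponential map, in the left trivialization. -/
noncomputable def dexpModel (s : ℕ) (x : EuclideanSpace ℝ (Fin d)) :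
    EuclideanSpace ℝ (Fin d) →L[ℝ] EuclideanSpace ℝ (Fin d) :=
  ∑ k ∈ range (s + 1), ((-1) ^ k / (k + 1).factorial : ℝ) • adModel d G x ^ k

theorem toModel_ad_pow (X Z : LieAlg d G) (k : ℕ) :
    toModel d G ((LieAlgebra.ad ℝ (LieAlg d G) X ^ k) Z)
      = (adModel d G (toModel d G X) ^ k) (toModel d G Z) := by
  induction k with
  | zero => rfl
  | succ k ih =>
    rw [pow_succ', pow_succ']
    calc toModel d G ⁅X, (LieAlgebra.ad ℝ (LieAlg d G) X ^ k) Z⁆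
      _ = adModel d G (toModel d G X) (toModel d G ((LieAlgebra.ad ℝ (LieAlg d G) X ^ k) Z)) :=
        toModel_lie d G X _
      _ = _ := by rw [ih]; rfl

theorem toModel_dexp (s : ℕ) (X Z : LieAlg d G) :
    toModel d G (dexp s X Z) = dexpModel d G s (toModel d G X) (toModel d G Z) := by
  simp [dexp, dexpModel, toModel_ad_pow]

theorem toModel_expAd (s : ℕ) (X Z : LieAlg d G) :
    toModel d G (expAd s X Z)
      = (∑ k ∈ range (s + 1), ((k.factorial : ℝ)⁻¹) • adModel d G (toModel d G X) ^ k)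
        (toModel d G Z) := by
  simp [expAd, toModel_ad_pow]

variable {s : ℕ}

theorem expAd_smul_self (X : LieAlg d G) (a : ℝ) : expAd s (a • X) X = X := by
  rw [expAd, sum_range_succ']
  simp [pow_succ]

theorem hasLeftDeriv_lieExp_mul_lieExp
    (hs : LieModule.lowerCentralSeries ℝ (LieAlg d G) (LieAlg d G) s = ⊥) (X Y : LieAlg d G)
    (t : ℝ) :
    HasLeftDeriv d (fun τ : ℝ ↦ (lieExp (τ • -X) * lieExp (τ • Y) : G))
      (toModel d G (expAd s ((-t) • Y) (Y - X))) t := by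
  convert (hasLeftDeriv_lieExp (G := G) (-X) t).mul (hasLeftDeriv_lieExp Y t) using 1
  rw [← lieExp_neg, adjoint_lieExp hs, neg_smul, ← map_add, sub_eq_add_neg, add_comm Y]
  congr 1
  rw [expAd, expAd]
  simp only [map_add, smul_add, sum_add_distrib]
  congr 1
  rw [← neg_smul]
  exact expAd_smul_self Y (-t)

theorem hasDerivAt_integral_expAd (Y Z : LieAlg d G) (t : ℝ) :
    HasDerivAt (fun t : ℝ ↦ toModel d G (∑ k ∈ range (s + 1),
      t ^ (k + 1) • ((-1) ^ k / (k + 1).factorial : ℝ) • (LieAlgebra.ad ℝ (LieAlg d G) Y ^ k) Z))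
      (toModel d G (expAd s ((-t) • Y) Z)) t := by
  simp only [map_sum, map_smul]
  have h2 := HasDerivAt.fun_sum (u := range (s + 1)) (x := t) (fun j _ ↦
    (hasDerivAt_pow (j + 1) t).smul_const (((-1) ^ j / (j + 1).factorial : ℝ) •
      toModel d G ((LieAlgebra.ad ℝ (LieAlg d G) Y ^ j) Z)))
  refine h2.congr_deriv ?_
  simp only [expAd, map_sum, map_smul]
  refine sum_congr rfl fun j _ ↦ ?_
  rw [smul_pow, LinearMap.smul_apply, map_smul, smul_smul, smul_smul, Nat.factorial_succ,
    Nat.add_sub_cancel, neg_pow t]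
  congr 1
  push_cast
  have := Nat.factorial_ne_zero j
  field_simp

/-- The curve `t ↦ exp (-t z) * exp (t y)` has left derivative `exp (-t ad y) (y - z)`, of size
`O(‖y - z‖)`, whose integral over `[0, 1]` is `dexp` at `y` applied to `y - z`. No prior regularity
of `exp` in its argument is needed. -/
theorem exists_norm_oneChart_lieExp_sub_le
    (hs : LieModule.lowerCentralSeries ℝ (LieAlg d G) (LieAlg d G) s = ⊥)
    (x : EuclideanSpace ℝ (Fin d)) :
    ∃ K > 0, ∀ᶠ p : EuclideanSpace ℝ (Fin d) × EuclideanSpace ℝ (Fin d) in 𝓝 (x, x),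
      (lieExp (-(toModel d G).symm p.2) * lieExp ((toModel d G).symm p.1) : G)
        ∈ (oneChart d G).source ∧
      ‖oneChart d G (lieExp (-(toModel d G).symm p.2) * lieExp ((toModel d G).symm p.1))
        - oneCoord d G‖ ≤ K * ‖p.1 - p.2‖ ∧
      ‖oneChart d G (lieExp (-(toModel d G).symm p.2) * lieExp ((toModel d G).symm p.1))
        - oneCoord d G - dexpModel d G s p.1 (p.1 - p.2)‖ ≤ K * ‖p.1 - p.2‖ ^ 2 := by
  obtain ⟨r, hr, K, hK, hfence⟩ := exists_norm_oneChart_sub_le d G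
  have hcont : Continuous fun x ↦
      ∑ k ∈ range (s + 1), ((k.factorial : ℝ)⁻¹) • adModel d G x ^ k := by fun_prop
  obtain ⟨M, hM⟩ := (isCompact_closedBall (0 : EuclideanSpace ℝ (Fin d)) (‖x‖ + 1)
    ).exists_bound_of_continuousOn hcont.continuousOn
  have hM0 : 0 ≤ M := (norm_nonneg _).trans (hM 0 (by simp; positivity))
  refine ⟨2 * (M + 1) + K * (M + 1) ^ 2, by positivity, ?_⟩
  have h1 : ∀ᶠ p : EuclideanSpace ℝ (Fin d) × EuclideanSpace ℝ (Fin d) in 𝓝 (x, x),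
      ‖p.1‖ < ‖x‖ + 1 :=
    (continuous_fst.norm.tendsto (x, x)).eventually_lt_const (lt_add_one _)
  have h2 : ∀ᶠ p : EuclideanSpace ℝ (Fin d) × EuclideanSpace ℝ (Fin d) in 𝓝 (x, x),
      2 * ((M + 1) * ‖p.1 - p.2‖) < r := by
    have : Continuous fun p : EuclideanSpace ℝ (Fin d) × EuclideanSpace ℝ (Fin d) ↦
      2 * ((M + 1) * ‖p.1 - p.2‖) := by fun_prop
    refine (this.tendsto (x, x)).eventually_lt_const ?_
    simpa using hr
  filter_upwards [h1, h2] with ⟨y, z⟩ hp1 hp2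
  dsimp only at hp1 hp2 ⊢
  rcases eq_or_ne y z with rfl | hyz
  · rw [lieExp_neg, inv_mul_cancel]
    refine ⟨mem_extChartAt_source (I := 𝓡 d) (1 : G), ?_, ?_⟩
    · rw [sub_self, sub_self, norm_zero, mul_zero]
    · simp only [sub_self, map_zero, norm_zero]
      positivity
  set Y := (toModel d G).symm y with hY
  set Z := (toModel d G).symm z with hZ
  have hδ : 0 < (M + 1) * ‖y - z‖ := by
    have := norm_pos_iff.2 (sub_ne_zero.2 hyz)
    positivity
  obtain ⟨h3, h4, h5⟩ := hfence _ hδ hp2.le _ _ _ (by simp [lieExp_zero])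
    (hasLeftDeriv_lieExp_mul_lieExp (G := G) hs Z Y)
    (hasDerivAt_integral_expAd (s := s) Y (Y - Z)) (fun t ht ↦ by
      rw [toModel_expAd]
      refine (ContinuousLinearMap.le_opNorm _ _).trans ?_
      have h6 := hM (toModel d G ((-t) • Y)) (by
        rw [mem_closedBall_zero_iff, map_smul, hY, LinearEquiv.apply_symm_apply, norm_smul,
          norm_neg, Real.norm_of_nonneg ht.1]
        nlinarith [norm_nonneg y, ht.2])
      have h7 : toModel d G (Y - Z) = y - z := by simp [hY, hZ]
      rw [h7]
      gcongr
      linarith)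
  have hQ : toModel d G (∑ k ∈ range (s + 1), (1 : ℝ) ^ (k + 1) •
      ((-1) ^ k / (k + 1).factorial : ℝ) • (LieAlgebra.ad ℝ (LieAlg d G) Y ^ k) (Y - Z))
      = dexpModel d G s y (y - z) := by
    have h7 := toModel_dexp s Y (Y - Z)
    rw [map_sub, hY, hZ, LinearEquiv.apply_symm_apply, LinearEquiv.apply_symm_apply] at h7
    rw [← h7]
    simp [dexp, hY, hZ]
  rw [hQ] at h5
  simp only [one_smul] at h3 h4 h5
  refine ⟨h3, h4.trans ?_, ?_⟩
  · have : 0 ≤ K * (M + 1) ^ 2 * ‖y - z‖ := by positivity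
    linarith
  · have h6 : (0 : EuclideanSpace ℝ (Fin d)) = toModel d G (∑ k ∈ range (s + 1),
      (0 : ℝ) ^ (k + 1) • ((-1) ^ k / (k + 1).factorial : ℝ) •
        (LieAlgebra.ad ℝ (LieAlg d G) Y ^ k) (Y - Z)) := by simp
    rw [← h6, sub_zero] at h5
    refine h5.trans ?_
    have : 0 ≤ 2 * (M + 1) * ‖y - z‖ ^ 2 := by positivity
    linarith

/-- The derivative of the exponential map. -/
theorem hasStrictFDerivAt_lieExp
    (hs : LieModule.lowerCentralSeries ℝ (LieAlg d G) (LieAlg d G) s = ⊥)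
    (x : EuclideanSpace ℝ (Fin d)) :
    HasStrictFDerivAt (fun y ↦ oneChart d G
      (lieExp (-(toModel d G).symm x) * lieExp ((toModel d G).symm y))) (dexpModel d G s x) x := by
  obtain ⟨K, hK, hest⟩ := exists_norm_oneChart_lieExp_sub_le (G := G) hs x
  have hstrict : HasStrictFDerivAt (chartMul d G)
      (ContinuousLinearMap.fst ℝ _ _ + ContinuousLinearMap.snd ℝ _ _)
      (oneCoord d G, oneCoord d G) := by
    have h := (contDiffAt_chartMul d G).hasStrictFDerivAt (by simp)
    rwa [hasFDerivAt_chartMul_oneCoord.fderiv] at h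
  have hcont : Continuous (dexpModel d G s) := by
    unfold dexpModel
    fun_prop
  have hx2 : Tendsto (fun p : EuclideanSpace ℝ (Fin d) × EuclideanSpace ℝ (Fin d) ↦ (p.2, x))
      (𝓝 (x, x)) (𝓝 (x, x)) := Continuous.tendsto' (by fun_prop) _ _ rfl
  refine hasStrictFDerivAt_of_local_mul (W := fun p ↦ oneChart d G
    (lieExp (-(toModel d G).symm p.2) * lieExp ((toModel d G).symm p.1))) hstrict
    hcont (hest.mono fun p hp ↦ hp.2) ?_ ?_
  · filter_upwards [hest, hx2.eventually hest] with p hp hp'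
    rw [chartMul, (oneChart d G).left_inv hp.1, (oneChart d G).left_inv hp'.1]
    rw [lieExp_neg ((toModel d G).symm p.2), mul_assoc, mul_inv_cancel_left]
  · filter_upwards [hest] with p hp
    rw [chartMul, (oneChart d G).left_inv hp.1, oneChart_symm_oneCoord, mul_one]

theorem dexpModel_surjective
    (hs : LieModule.lowerCentralSeries ℝ (LieAlg d G) (LieAlg d G) s = ⊥)
    (x : EuclideanSpace ℝ (Fin d)) : Function.Surjective (dexpModel d G s x) := by
  intro y
  have h := congrArg (toModel d G)
    (dexp_sum_dexpInvCoeff hs ((toModel d G).symm x) ((toModel d G).symm y))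
  rw [toModel_dexp, LinearEquiv.apply_symm_apply, LinearEquiv.apply_symm_apply] at h
  exact ⟨_, h⟩

theorem eventually_lieExp_eq
    (hs : LieModule.lowerCentralSeries ℝ (LieAlg d G) (LieAlg d G) s = ⊥)
    (x : EuclideanSpace ℝ (Fin d)) : ∀ᶠ y in 𝓝 x,
      (lieExp ((toModel d G).symm y) : G) = lieExp ((toModel d G).symm x) *
        (oneChart d G).symm (oneChart d G
          (lieExp (-(toModel d G).symm x) * lieExp ((toModel d G).symm y))) := by
  obtain ⟨K, -, hest⟩ := exists_norm_oneChart_lieExp_sub_le (G := G) hs x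
  have h : Tendsto (fun y ↦ (y, x)) (𝓝 x) (𝓝 (x, x)) := Continuous.tendsto' (by fun_prop) _ _ rfl
  filter_upwards [h.eventually hest] with y hy
  rw [(oneChart d G).left_inv hy.1, lieExp_neg, mul_inv_cancel_left]

/-- `dexp` is onto, so the inverse function theorem makes `exp` open at every point. This single
equality of filters gives both continuity and openness. -/
theorem map_lieExp_nhds
    (hs : LieModule.lowerCentralSeries ℝ (LieAlg d G) (LieAlg d G) s = ⊥)
    (x : EuclideanSpace ℝ (Fin d)) :
    map (fun y ↦ (lieExp ((toModel d G).symm y) : G)) (𝓝 x)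
      = 𝓝 (lieExp ((toModel d G).symm x)) := by
  have := topologicalGroup_of_lieGroup (𝓡 d) ∞ (G := G)
  have h1 := (hasStrictFDerivAt_lieExp (G := G) hs x).map_nhds_eq_of_surj
    (LinearMap.range_eq_top.2 (dexpModel_surjective hs x))
  rw [map_congr (eventually_lieExp_eq hs x)]
  rw [lieExp_neg, inv_mul_cancel] at h1
  have h2 : (fun y ↦ (lieExp ((toModel d G).symm x) * (oneChart d G).symm (oneChart d G
          (lieExp (-(toModel d G).symm x) * lieExp ((toModel d G).symm y))) : G))
      = (fun g ↦ lieExp ((toModel d G).symm x) * g) ∘ (oneChart d G).symm ∘ fun y ↦ (oneChart d G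
          (lieExp (-(toModel d G).symm x) * lieExp ((toModel d G).symm y))) := rfl
  have h3 := map_extChartAt_symm_nhdsWithin_range (I := 𝓡 d) (1 : G)
  rw [ModelWithCorners.range_eq_univ, nhdsWithin_univ] at h3
  rw [lieExp_neg] at h2 ⊢
  rw [h2, ← Filter.map_map, ← Filter.map_map, h1, h3, map_mul_left_nhds, mul_one]

theorem continuous_lieExp
    (hs : LieModule.lowerCentralSeries ℝ (LieAlg d G) (LieAlg d G) s = ⊥) :
    Continuous fun y : EuclideanSpace ℝ (Fin d) ↦ (lieExp ((toModel d G).symm y) : G) :=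
  continuous_iff_continuousAt.2 fun x ↦ (map_lieExp_nhds hs x).le

theorem isOpenMap_lieExp
    (hs : LieModule.lowerCentralSeries ℝ (LieAlg d G) (LieAlg d G) s = ⊥) :
    IsOpenMap fun y : EuclideanSpace ℝ (Fin d) ↦ (lieExp ((toModel d G).symm y) : G) :=
  isOpenMap_iff_nhds_le.2 fun x ↦ (map_lieExp_nhds hs x).ge

theorem hasLeftDeriv_lieExp_comp
    (hs : LieModule.lowerCentralSeries ℝ (LieAlg d G) (LieAlg d G) s = ⊥)
    {c : ℝ → LieAlg d G} {Z : LieAlg d G} {t : ℝ}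
    (hc : HasDerivAt (fun τ ↦ toModel d G (c τ)) (toModel d G Z) t) :
    HasLeftDeriv d (fun τ ↦ (lieExp (c τ) : G)) (toModel d G (dexp s (c t) Z)) t := by
  refine ⟨?_, ?_⟩
  · have h := ((continuous_lieExp (G := G) hs).tendsto _).comp hc.continuousAt.tendsto
    simp only [LinearEquiv.symm_apply_apply] at h
    exact h
  · have h := (hasStrictFDerivAt_lieExp (G := G) hs (toModel d G (c t))).hasFDerivAt.comp_hasDerivAt
      t hc
    rw [← toModel_dexp] at h
    refine h.congr_of_eventuallyEq (Eventually.of_forall fun τ ↦ ?_)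
    simp only [lieExp_neg, LinearEquiv.symm_apply_apply]
    rfl

/-- The Baker–Campbell–Hausdorff formula. -/
theorem lieExp_mul_lieExp
    (hs : LieModule.lowerCentralSeries ℝ (LieAlg d G) (LieAlg d G) s = ⊥) (X Y : LieAlg d G) :
    (lieExp X * lieExp Y : G) = lieExp (bch s X Y) := by
  -- The curve `bchCurve` was built so that `dexp` turns its derivative into the constant `Y`. Thus
  -- its exponential has the same left derivative and starting point as `τ ↦ exp X * exp (τ Y)`.
  have h1 : ∀ t, HasLeftDeriv d (fun τ ↦ (lieExp (bchCurve s X Y τ) : G)) (toModel d G Y) t := by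
    intro t
    have h := hasLeftDeriv_lieExp_comp (G := G) (c := bchCurve s X Y) (Z := bchCurveDeriv s X Y t)
      (t := t) hs ?_
    · rwa [dexp_bchCurveDeriv hs] at h
    simp only [bchCurve, bchCurveDeriv, map_sum, map_smul]
    have h2 := HasDerivAt.fun_sum (u := range (s + 1)) (x := t) (fun j _ ↦
      (hasDerivAt_pow j t).smul_const (toModel d G (bchCoeff s X Y j)))
    refine h2.congr_deriv ?_
    rw [sum_range_succ']
    simp [smul_smul, mul_comm]
  have h2 := congrFun (eq_of_hasLeftDeriv (fun t ↦ (hasLeftDeriv_lieExp Y t).const_mul (lieExp X))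
    h1 (by simp [lieExp_zero, bchCurve_zero])) 1
  simpa [bchCurve_one] using h2

end ExpDerivative

/-! ### Bijectivity of the exponential map -/

section ExpBijective

variable {d : ℕ} {G : Type u} [TopologicalSpace G] [ChartedSpace (EuclideanSpace ℝ (Fin d)) G]
  [Group G] [LieGroup (𝓡 d) ∞ G] {s : ℕ}

theorem lieExp_zsmul (n : ℤ) (X : LieAlg d G) : (lieExp (n • X) : G) = lieExp X ^ n := by
  rw [← Int.cast_smul_eq_zsmul ℝ]
  induction n with
  | zero => simp [lieExp_zero]
  | succ n ih =>
    push_cast at ih ⊢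
    rw [lieExp_add_smul, ih, one_smul, zpow_add_one]
  | pred n ih =>
    push_cast at ih ⊢
    rw [sub_eq_add_neg, lieExp_add_smul, ih, neg_one_smul, lieExp_neg, zpow_sub_one]

theorem lieExp_add (hs : LieModule.lowerCentralSeries ℝ (LieAlg d G) (LieAlg d G) s = ⊥)
    {X Y : LieAlg d G} (h : ⁅Y, X⁆ = 0) : (lieExp (X + Y) : G) = lieExp X * lieExp Y := by
  have h1 := hasLeftDeriv_lieExp_mul_lieExp (G := G) hs (-X) Y
  have h2 : ∀ t : ℝ, expAd s ((-t) • Y) (Y - -X) = X + Y := by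
    intro t
    rw [expAd, sum_range_succ']
    simp [pow_succ, h, add_comm]
  simp only [h2, neg_neg] at h1
  simpa using congrFun
    (eq_of_hasLeftDeriv (hasLeftDeriv_lieExp (X + Y)) h1 (by simp [lieExp_zero])) 1

/-- `exp (nX) = exp (nY)` for every natural `n`, so `exp (n ad X) Z = exp (n ad Y) Z`. Both sides
are polynomial in `n`, hence their linear coefficients agree. -/
theorem lie_eq_of_lieExp_eq
    (hs : LieModule.lowerCentralSeries ℝ (LieAlg d G) (LieAlg d G) s = ⊥)
    {X Y : LieAlg d G} (h : (lieExp X : G) = lieExp Y) (Z : LieAlg d G) : ⁅X, Z⁆ = ⁅Y, Z⁆ := by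
  rcases Nat.eq_zero_or_pos s with rfl | hs0
  · rw [subsingleton_of_lcs_zero hs ⁅X, Z⁆, subsingleton_of_lcs_zero hs ⁅Y, Z⁆]
  rw [← (toModel d G).injective.eq_iff]
  ext i
  set p : Polynomial ℝ := ∑ k ∈ range (s + 1), Polynomial.C ((k.factorial : ℝ)⁻¹ *
    (toModel d G ((LieAlgebra.ad ℝ (LieAlg d G) X ^ k) Z) i
      - toModel d G ((LieAlgebra.ad ℝ (LieAlg d G) Y ^ k) Z) i)) * Polynomial.X ^ k with hp
  have hroot : ∀ n : ℕ, p.IsRoot (n : ℝ) := by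
    intro n
    have h1 : (lieExp ((n : ℝ) • X) : G) = lieExp ((n : ℝ) • Y) := by
      have h2 := lieExp_zsmul (G := G) n X
      have h3 := lieExp_zsmul (G := G) n Y
      rw [natCast_zsmul, ← Nat.cast_smul_eq_nsmul ℝ] at h2 h3
      rw [h2, h3, h]
    have h2 := congrArg (fun v ↦ v i) (congrArg (fun g ↦ adjoint d g (toModel d G Z)) h1)
    simp only [adjoint_lieExp hs, expAd, map_sum, map_smul, smul_pow, LinearMap.smul_apply] at h2
    rw [← sub_eq_zero] at h2
    rw [Polynomial.IsRoot, hp, Polynomial.eval_finsetSum, ← h2]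
    simp only [Polynomial.eval_mul, Polynomial.eval_C, Polynomial.eval_pow, Polynomial.eval_X]
    simp only [WithLp.ofLp_sum, Finset.sum_apply, PiLp.smul_apply, smul_eq_mul]
    rw [← sum_sub_distrib]
    exact sum_congr rfl fun k _ ↦ by ring
  have hp0 : p = 0 := by
    refine p.eq_zero_of_infinite_isRoot (Set.Infinite.mono ?_
      (Set.infinite_range_of_injective (Nat.cast_injective (R := ℝ))))
    rintro _ ⟨n, rfl⟩
    exact hroot n
  have h1 := congrArg (fun p ↦ Polynomial.coeff p 1) hp0
  simp only [hp, Polynomial.finsetSum_coeff, Polynomial.coeff_C_mul, Polynomial.coeff_X_pow,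
    Polynomial.coeff_zero, mul_ite, mul_one, mul_zero] at h1
  rw [sum_ite_eq, if_pos (by simp; lia)] at h1
  simpa [sub_eq_zero] using h1

/-- If the exponentials agree then `ad X = ad Y`, so `X` and `Y` commute; if `exp (Y - X) = 1` then
`Y - X` is central. In either case `exp` is additive on the elements involved. -/
theorem lieExp_eq_iff (hs : LieModule.lowerCentralSeries ℝ (LieAlg d G) (LieAlg d G) s = ⊥)
    {X Y : LieAlg d G} : (lieExp X : G) = lieExp Y ↔ (lieExp (Y - X) : G) = 1 := by
  constructor
  · intro h
    rw [sub_eq_add_neg, lieExp_add hs, lieExp_neg, h, mul_inv_cancel]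
    rw [neg_lie, lie_eq_of_lieExp_eq hs h, lie_self, neg_zero]
  · intro h
    have h1 : ∀ Z : LieAlg d G, ⁅Y - X, Z⁆ = 0 := fun Z ↦ by
      rw [lie_eq_of_lieExp_eq (Y := (0 : LieAlg d G)) hs (by rw [h, lieExp_zero]), zero_lie]
    have h2 := lieExp_add (G := G) hs (X := Y - X) (Y := X)
      (by rw [← lie_skew, h1, neg_zero])
    rw [h, one_mul, sub_add_cancel] at h2
    exact h2.symm

/-- By the BCH formula the image is a subgroup; it is open, hence closed, hence everything. -/
theorem lieExp_surjective [ConnectedSpace G]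
    (hs : LieModule.lowerCentralSeries ℝ (LieAlg d G) (LieAlg d G) s = ⊥) :
    Function.Surjective (lieExp : LieAlg d G → G) := by
  have := topologicalGroup_of_lieGroup (𝓡 d) ∞ (G := G)
  let H : Subgroup G :=
    { carrier := Set.range lieExp
      mul_mem' := by
        rintro _ _ ⟨X, rfl⟩ ⟨Y, rfl⟩
        exact ⟨_, (lieExp_mul_lieExp hs X Y).symm⟩
      one_mem' := ⟨0, lieExp_zero⟩
      inv_mem' := by
        rintro _ ⟨X, rfl⟩
        exact ⟨-X, lieExp_neg X⟩ }
  have hH : IsOpen (H : Set G) := by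
    have h := (isOpenMap_lieExp (G := G) hs).isOpen_range
    rwa [show (fun y ↦ (lieExp ((toModel d G).symm y) : G)) = lieExp ∘ (toModel d G).symm from rfl,
      (toModel d G).symm.surjective.range_comp] at h
  have h : (H : Set G) = Set.univ := IsClopen.eq_univ ⟨H.isClosed_of_isOpen hH, hH⟩ ⟨1, H.one_mem⟩
  exact Set.range_eq_univ.1 h

theorem lieExp_injective [SimplyConnectedSpace G]
    (hs : LieModule.lowerCentralSeries ℝ (LieAlg d G) (LieAlg d G) s = ⊥) :
    Function.Injective (lieExp : LieAlg d G → G) := by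
  let f : EuclideanSpace ℝ (Fin d) → G := fun y ↦ lieExp ((toModel d G).symm y)
  have hker : ∀ {x y}, f x = f y ↔ f (y - x) = 1 := fun {x y} ↦ by
    simp only [f, map_sub]
    exact lieExp_eq_iff hs
  have hf0 : f 0 = 1 := by simp only [f, map_zero, lieExp_zero]
  let K : AddSubgroup (EuclideanSpace ℝ (Fin d)) := AddSubgroup.ofSub {x | f x = 1} ⟨0, hf0⟩
    fun {x} hx {y} hy ↦ by
      have h : f y = f x := Eq.trans hy (Eq.symm hx)
      rw [← sub_eq_add_neg]
      exact hker.1 h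
  have hquot : IsQuotientMap f := (isOpenMap_lieExp hs).isQuotientMap (continuous_lieExp hs)
    ((lieExp_surjective hs).comp (toModel d G).symm.surjective)
  -- If `exp y = 1`, the development at `(y, 0)` gives `‖y‖ ≤ C * ‖y‖ ^ 2`, because `dexp` at `y`
  -- fixes `y`. So `0` is the only such `y` with `C * ‖y‖ < 1`.
  have hdisc : IsDiscrete (K : Set (EuclideanSpace ℝ (Fin d))) := by
    constructor
    change DiscreteTopology K
    obtain ⟨C, hC, hest⟩ := exists_norm_oneChart_lieExp_sub_le (G := G) hs 0
    have ht : Tendsto (fun y : K ↦ ((y : EuclideanSpace ℝ (Fin d)), (0 : EuclideanSpace ℝ (Fin d))))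
        (𝓝 0) (𝓝 (0, 0)) := Continuous.tendsto' (by fun_prop) _ _ rfl
    have hn : Tendsto (fun y : K ↦ C * ‖(y : EuclideanSpace ℝ (Fin d))‖) (𝓝 0) (𝓝 0) :=
      Continuous.tendsto' (by fun_prop) _ _ (by simp)
    refine discreteTopology_of_isOpen_singleton_zero (isOpen_singleton_iff_nhds_eq_pure _ |>.2 ?_)
    refine le_antisymm ?_ (pure_le_nhds _)
    rw [le_pure_iff]
    filter_upwards [ht.eventually hest, hn.eventually_lt_const one_pos] with y hy hy1
    have h1 := hy.2.2
    have h2 : lieExp ((toModel d G).symm y) = (1 : G) := y.2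
    have h3 : dexpModel d G s y y = y := by
      have h4 := toModel_dexp (G := G) s ((toModel d G).symm y) ((toModel d G).symm y)
      rw [LinearEquiv.apply_symm_apply] at h4
      rw [← h4, dexp, sum_range_succ']
      simp [pow_succ]
    simp only [map_zero, neg_zero, lieExp_zero, h2, mul_one, sub_self, sub_zero, zero_sub, norm_neg,
      h3] at h1
    have h5 : ‖(y : EuclideanSpace ℝ (Fin d))‖ = 0 := by
      by_contra h6
      have h7 : 0 < ‖(y : EuclideanSpace ℝ (Fin d))‖ := lt_of_le_of_ne (norm_nonneg _) (Ne.symm h6)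
      nlinarith
    exact Subtype.ext (norm_eq_zero.1 h5)
  have hcov := hquot.isAddQuotientCoveringMap_of_addSubgroup K hdisc (fun {x y} ↦ by
    rw [← sub_eq_add_neg]
    exact hker)
  -- For the covering by the connected space of the Lie algebra, the fundamental group of `G` maps
  -- onto the deck group `K`; it is trivial, hence so is `K`.
  have hK : ∀ y, f y = 1 → y = 0 := by
    intro y hy
    obtain ⟨γ, hγ⟩ := hcov.fundamentalGroupToMulOpposite_surjective (x := 1) ⟨0, hf0⟩
      (MulOpposite.op (Multiplicative.ofAdd (⟨y, hy⟩ : K)))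
    rw [Subsingleton.elim γ 1, map_one] at hγ
    have h := congrArg (fun z ↦ ((Multiplicative.toAdd (MulOpposite.unop z) : K) :
      EuclideanSpace ℝ (Fin d))) hγ
    exact h.symm
  intro X Y h
  have h1 := hK (toModel d G (Y - X)) (by
    simp only [f, LinearEquiv.symm_apply_apply]
    exact (lieExp_eq_iff hs).1 h)
  rw [LinearEquiv.map_eq_zero_iff, sub_eq_zero] at h1
  exact h1.symm

theorem isNilpotentExp_lieExp [SimplyConnectedSpace G]
    (hs : LieModule.lowerCentralSeries ℝ (LieAlg d G) (LieAlg d G) s = ⊥) :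
    IsNilpotentExp s (Equiv.ofBijective (lieExp : LieAlg d G → G)
      ⟨lieExp_injective hs, lieExp_surjective hs⟩) where
  lcs := hs
  mul := lieExp_mul_lieExp hs
  conj := lieExp_conj hs
  zpow := lieExp_zsmul

end ExpBijective

/-! ### Images under `exp` and `log` through the equivalence -/

section Logarithm

variable {d : ℕ} {G : Type u} [TopologicalSpace G] [ChartedSpace (EuclideanSpace ℝ (Fin d)) G]
  [Group G] [LieGroup (𝓡 d) ∞ G] {e : LieAlg d G ≃ G}

theorem expSet_eq (he : ∀ X, e X = lieExp X) (A : Set (LieAlg d G)) : expSet A = e '' A := by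
  simp only [expSet, he]

theorem logSet_eq (he : ∀ X, e X = lieExp X) (S : Set G) : logSet (d := d) S = e ⁻¹' S := by
  have h1 : (lieExp : LieAlg d G → G) = e := funext fun X ↦ (he X).symm
  have h2 : (lieLog : G → LieAlg d G) = e.symm := by
    rw [lieLog, h1]
    exact Function.invFun_eq_of_injective_of_rightInverse e.injective e.apply_symm_apply
  rw [logSet, h2, Equiv.image_symm_eq_preimage]

end Logarithm

end NilLie

theorem theorem4p2 (s : ℕ) :
    ∃ C₁ C₂ : ℕ, 0 < C₁ ∧ 0 < C₂ ∧
      ∀ (d : ℕ) (G : Type u) [TopologicalSpace G] [ChartedSpace (EuclideanSpace ℝ (Fin d)) G]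
        [Group G] [LieGroup (𝓡 d) ∞ G] [SimplyConnectedSpace G] [Group.IsNilpotent G],
        NilLie.HasStep d G s →
        ∀ Γ : Subgroup G,
          (∃ H : Subgroup G, (H : Set G) = NilLie.hMinus d C₁ Γ ∧ NilLie.IsHarmonious d H) ∧
          (∃ H : Subgroup G, (H : Set G) = NilLie.hPlus d C₁ Γ ∧ NilLie.IsHarmonious d H) ∧
          (C₁ : ℝ) • NilLie.logSet (d := d) (Γ : Set G) ⊆ NilLie.logSet (NilLie.hMinus d C₁ Γ) ∧
          NilLie.logSet (d := d) (NilLie.hMinus d C₁ Γ) ⊆ NilLie.logSet (Γ : Set G) ∧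
          NilLie.logSet (d := d) (Γ : Set G) ⊆ NilLie.logSet (NilLie.hPlus d C₁ Γ) ∧
          NilLie.logSet (d := d) (NilLie.hPlus d C₁ Γ) ⊆
            (1 / (C₂ : ℝ)) • NilLie.logSet (Γ : Set G) := by
  obtain ⟨C₁, C₂, hC₁, hC₂, h⟩ := NilLie.exists_harmonious_constants.{0, u} s
  refine ⟨C₁, C₂, hC₁, hC₂, fun d G _ _ _ _ _ _ hstep Γ ↦ ?_⟩
  have hs : LieModule.lowerCentralSeries ℝ (NilLie.LieAlg d G) (NilLie.LieAlg d G) s = ⊥ := hstep.1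
  have hexp := NilLie.isNilpotentExp_lieExp (G := G) hs
  set e : NilLie.LieAlg d G ≃ G := Equiv.ofBijective NilLie.lieExp
    ⟨NilLie.lieExp_injective hs, NilLie.lieExp_surjective hs⟩
  have he : ∀ X, e X = NilLie.lieExp X := fun X ↦ rfl
  obtain ⟨⟨⟨H, hH⟩, hHadd, hHbr⟩, ⟨⟨J, hJ⟩, hJadd, hJbr⟩, h1, h2, h3, h4⟩ :=
    h (NilLie.LieAlg d G) G e hexp Γ _ _ _ rfl rfl rfl
  simp only [NilLie.hMinus, NilLie.hPlus, NilLie.IsHarmonious, NilLie.expSet_eq he,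
    NilLie.logSet_eq he, Equiv.preimage_image]
  refine ⟨⟨H, ?_, ?_, ?_⟩, ⟨J, ?_, ?_, ?_⟩, h1, h2, h3, h4⟩
  · rw [← hH, Equiv.image_preimage]
  · rwa [hH]
  · rwa [hH]
  · rw [← hJ, Equiv.image_preimage]
  · rwa [hJ]
  · rwa [hJ]
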